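/- Let $\mathbb k$ be a field. A finite cell complex $K$ is a finite poset of cells ($\tau\le\sigma$ when $\tau$ is a face of $\sigma$) with dimensions $\dim\sigma\in\mathbb N$ and incidence coefficients $[\sigma:\tau]\in\mathbb k$ that vanish unless $\tau\le\sigma$ and $\dim\sigma=\dim\tau+1$ and satisfy $\sum_\tau[\sigma:\tau][\tau:\rho]=0$; every finite simplicial or CW complex with its cellular boundary is an example. A weight on $K$ is a monotone map $w:K\to\mathbb R$, and $K^w_t=\{\sigma: w(\sigma)\le t\}$. Fix real numbers $c,d$. Taking $t\in[c,d]$, the filtered complex $C_\bullet(K^w_t;\mathbb k)$ has homology $\operatorname{Dgm}_i(w)=H_i(K^w_\bullet;\mathbb k)$, a persistence module indexed by $[c,d]$. For interval modules put $d_{\mathrm{rk}}(I,J)=\int_{r\le s}|\operatorname{rank} I_{r\le s}-\operatorname{rank} J_{r\le s}|\,dr\,ds$ (over $r,s\in[c,d]$), and let $W_1^{\mathrm{rk}}(M,N)$ be the least total cost $\sum d_{\mathrm{rk}}$ of a partial matching between the intervals in the interval decompositions of $M$ and $N$, where unmatched intervals are matched with the zero module. Let $I_x$ be the interval module, indexed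 by $[c,d]$, with support $\{t\in[c,d]: t\ge x\}$. The barcode inequalities on $[c,d]$ for weights $w,v$ on $K$ are $$\sum_i W_1^{\mathrm{rk}}(\operatorname{Dgm}_i(w),\operatorname{Dgm}_i(v))\le\sum_{\sigma\in K} d_{\mathrm{rk}}(I_{w(\sigma)},I_{v(\sigma)})$$ and, for every $i\in\mathbb N$, $$W_1^{\mathrm{rk}}(\operatorname{Dgm}_i(w),\operatorname{Dgm}_i(v))\le\sum_{\dim\sigma\in\{i,i+1\}} d_{\mathrm{rk}}(I_{w(\sigma)},I_{v(\sigma)}).$$ Let $a\le b$ be real and let $\mathcal K$ be a class of finite cell complexes that contains all finite simplicial complexes. We say that the map from filtered complexes indexed by $[c,d]$ to diagrams is stable for weights valued in $[a,b]$ if (i) every weight $w:K\to[a,b]$ with $K\in\mathcal K$ is represented by its filtration indexed by $[c,d]$, i.e. every cell $\sigma$ is born in $(K^w_t)_{t\in[c,d]}$ exactly at the parameter $w(\sigma)$ (so that it generates the free module $I_{[w(\sigma),d]}$), and (ii) the barcode inequalities on $[c,d]$ hold for all $K\in\mathcal K$ and all weights $w,v:K\to[a,b]$. Then: 1. The map is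 stable on $[c,d]$ if and only if $c\le a$ and $d\ge 2b-a$. 2. If $c\le a<d$, then condition (ii) alone holds if and only if $d\ge 2b-a$. 3. The interval $[a,2b-a]$ is optimal: the map is stable on it; every $[c,d]$ on which the map is stable contains it; and for every such $[c,d]$, every $K\in\mathcal K$, all weights $w,v:K\to[a,b]$ and every cell $\sigma\in K$, the term $d_{\mathrm{rk}}(I_{w(\sigma)},I_{v(\sigma)})$ formed on $[a,2b-a]$ is at most the same term formed on $[c,d]$. -/

import Mathlib

open CategoryTheory CategoryTheory.Limits MeasureTheory
open scoped ENNReal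

noncomputable section

universe u

/-- A finite cell complex with incidence coefficients in the field `k`: a finite poset of cells
(`τ ≤ σ` when `τ` is a face of `σ`), a dimension function, and incidence coefficients `inc σ τ`
(the coefficient of `τ` in the boundary of `σ`), supported on codimension-one faces, with
vanishing squared boundary.  The cells of every finite simplicial, cubical or CW complex, with its
cellular boundary taken with coefficients in `k`, are of this form. -/
structure CellComplex (k : Type u) [Field k] where
  Cell : Type
  [fintypeCell : Fintype Cell]
  [orderCell : PartialOrder Cell]
  dim : Cell → ℕ
  inc : Cell → Cell → k
  face_of_inc : ∀ σ τ, inc σ τ ≠ 0 → τ ≤ σ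
  dim_of_inc : ∀ σ τ, inc σ τ ≠ 0 → dim σ = dim τ + 1
  inc_inc : ∀ σ ρ, ∑ τ, inc σ τ * inc τ ρ = 0

attribute [instance] CellComplex.fintypeCell CellComplex.orderCell

namespace CellComplex

variable {k : Type u} [Field k]

/-- `K` is (isomorphic to) a finite abstract simplicial complex on the ordered vertices
`0, …, n - 1`: `e` identifies the cells with a downward closed family of nonempty vertex sets,
and the boundary of `{v₀ < … < vₘ}` is `∑ⱼ (-1)ʲ {v₀, …, v̂ⱼ, …, vₘ}`. -/
def IsSimplicial (K : CellComplex k) : Prop :=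
  ∃ (n : ℕ) (e : K.Cell → Finset (Fin n)),
    Function.Injective e ∧
    (∀ σ, (e σ).Nonempty) ∧
    (∀ σ, ∀ s ⊆ e σ, s.Nonempty → ∃ τ, e τ = s) ∧
    (∀ σ τ, τ ≤ σ ↔ e τ ⊆ e σ) ∧
    (∀ σ, (e σ).card = K.dim σ + 1) ∧
    (∀ σ τ, K.inc σ τ =
      ∑ v ∈ e σ, if e τ = (e σ).erase v then (-1) ^ ((e σ).filter (· < v)).card else 0)

/-- The sublevel complex `K^w_t` of a weight `w` (a monotone function on the face poset). -/
def sublevel (K : CellComplex k) (w : K.Cell →o ℝ) (t : ℝ) : Set K.Cell := {σ | w σ ≤ t}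

/-- The boundary operator on all chains of `K`. -/
def boundary (K : CellComplex k) : (K.Cell → k) →ₗ[k] (K.Cell → k) where
  toFun f τ := ∑ σ, f σ * K.inc σ τ
  map_add' f g := by
    ext τ
    simp [add_mul, Finset.sum_add_distrib]
  map_smul' r f := by
    ext τ
    simp [mul_assoc, Finset.mul_sum]

theorem boundary_boundary (K : CellComplex k) (f : K.Cell → k) :
    K.boundary (K.boundary f) = 0 := by
  ext ρ
  simp only [boundary, LinearMap.coe_mk, AddHom.coe_mk, Finset.sum_mul, Pi.zero_apply]
  rw [Finset.sum_comm]
  refine Finset.sum_eq_zero fun σ _ => ?_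
  simp only [mul_assoc]
  rw [← Finset.mul_sum, K.inc_inc, mul_zero]

/-- The chain group `C_i(K^w_t; k)`: the chains supported on the `i`-cells of `K^w_t`. -/
def chains (K : CellComplex k) (w : K.Cell →o ℝ) (t : ℝ) (i : ℕ) : Submodule k (K.Cell → k) where
  carrier := {f | ∀ σ, f σ ≠ 0 → σ ∈ K.sublevel w t ∧ K.dim σ = i}
  zero_mem' := by
    intro σ h
    exact absurd rfl h
  add_mem' := by
    intro f g hf hg σ h
    by_cases hfσ : f σ = 0
    · exact hg σ (by simpa [hfσ] using h)
    · exact hf σ hfσ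
  smul_mem' := by
    intro r f hf σ h
    exact hf σ (right_ne_zero_of_mul h)

theorem chains_mono (K : CellComplex k) (w : K.Cell →o ℝ) {s t : ℝ} (h : s ≤ t) (i : ℕ) :
    K.chains w s i ≤ K.chains w t i :=
  fun _ hf σ hσ => ⟨le_trans (hf σ hσ).1 h, (hf σ hσ).2⟩

theorem boundary_mem (K : CellComplex k) (w : K.Cell →o ℝ) (t : ℝ) (i : ℕ) :
    ∀ f ∈ K.chains w t (i + 1), K.boundary f ∈ K.chains w t i := by
  intro f hf τ hτ
  obtain ⟨σ, -, hσ⟩ := Finset.exists_ne_zero_of_sum_ne_zero hτ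
  have h1 := hf σ (left_ne_zero_of_mul hσ)
  have h2 := right_ne_zero_of_mul hσ
  refine ⟨le_trans (w.monotone (K.face_of_inc σ τ h2)) h1.1, ?_⟩
  have h3 := K.dim_of_inc σ τ h2
  have h4 := h1.2
  omega

/-- The chain complex `C_•(K^w_t; k)`. -/
def chainComplex (K : CellComplex k) (w : K.Cell →o ℝ) (t : ℝ) : ChainComplex (ModuleCat.{u} k) ℕ :=
  ChainComplex.of (fun i => ModuleCat.of k (K.chains w t i))
    (fun i => ModuleCat.ofHom (K.boundary.restrict (K.boundary_mem w t i)))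
    (fun i => by
      ext f : 2
      exact Subtype.ext (K.boundary_boundary f.1))

/-- The filtered chain complex `C_•(K^w_•; k)`, indexed by the interval `[c, d]`; its structure
maps are the inclusions. -/
def filteredComplex (K : CellComplex k) (w : K.Cell →o ℝ) (c d : ℝ) :
    Set.Icc c d ⥤ ChainComplex (ModuleCat.{u} k) ℕ where
  obj t := K.chainComplex w t
  map {s t} h := ChainComplex.ofHom (V := ModuleCat.{u} k)
    (fun i => ModuleCat.ofHom (Submodule.inclusion (K.chains_mono w (leOfHom h) i)))
    (fun i => by
      simp only [chainComplex, ChainComplex.of_d]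
      rfl)
  map_id t := by
    ext i : 1
    rfl
  map_comp f g := by
    ext i : 1
    rfl

end CellComplex

/-- Persistence modules over `k` indexed by the poset `[c, d]`. -/
abbrev PersistenceModule (k : Type u) [Field k] (c d : ℝ) := Set.Icc c d ⥤ ModuleCat.{u} k

instance (k : Type u) [Field k] (c d : ℝ) : HasFiniteBiproducts (PersistenceModule k c d) :=
  Abelian.hasFiniteBiproducts

/-- The intervals of the poset `[c, d]` (the empty one included). -/
abbrev IndexInterval (c d : ℝ) := {I : Set (Set.Icc c d) // I.OrdConnected}

section Persistence

variable (k : Type u) [Field k] {c d : ℝ}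

/-- The value at `t` of the interval module of `I`, as a subspace of `k`: it is `k` if `t ∈ I` and
`0` otherwise. -/
def intervalFiber (I : IndexInterval c d) (t : Set.Icc c d) : Submodule k k where
  carrier := {x | t ∉ I.1 → x = 0}
  zero_mem' := fun _ => rfl
  add_mem' := by
    intro x y hx hy h
    rw [hx h, hy h, add_zero]
  smul_mem' := by
    intro r x hx h
    rw [hx h, smul_zero]

open Classical in
/-- The interval module of `I`: `k` on `I` and `0` elsewhere, with the identity of `k` between
points of `I` and `0` otherwise.  The interval module of the empty set is the zero module. -/
def intervalModule (I : IndexInterval c d) : PersistenceModule k c d where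
  obj t := ModuleCat.of k (intervalFiber k I t)
  map {s t} _ := ModuleCat.ofHom (LinearMap.codRestrict (intervalFiber k I t)
    ((if t ∈ I.1 then LinearMap.id else 0) ∘ₗ (intervalFiber k I s).subtype)
    (fun x h => by simp [h]))
  map_id t := by
    ext ⟨x, hx⟩
    by_cases h : t ∈ I.1
    · simp [h]
    · simp [h, hx h]
  map_comp {r s t} f g := by
    ext ⟨x, hx⟩
    by_cases hr : r ∈ I.1
    · by_cases ht : t ∈ I.1
      · have hs : s ∈ I.1 := I.2.out hr ht ⟨leOfHom f, leOfHom g⟩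
        simp [hs, ht]
      · simp [ht]
    · obtain rfl : x = 0 := hx hr
      exact (map_zero _).trans (((congrArg _ (map_zero _)).trans (map_zero _)).symm)

variable {k}

open Classical in
/-- The rank function `(r, s) ↦ rank M_{r ≤ s}`, on the pairs `r ≤ s` of `[c, d]`, extended by
zero to the plane. -/
def rankFunction (M : PersistenceModule k c d) (p : ℝ × ℝ) : ℝ :=
  if h : p.1 ∈ Set.Icc c d ∧ p.2 ∈ Set.Icc c d ∧ p.1 ≤ p.2 then
    (Module.finrank k (LinearMap.range
      (M.map (homOfLE h.2.2 : (⟨p.1, h.1⟩ : Set.Icc c d) ⟶ ⟨p.2, h.2.1⟩)).hom) : ℝ)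
  else 0

variable (k)

/-- `d_rk(I, J) = ∫ |rank I - rank J|` for interval modules. -/
def dRk (I J : IndexInterval c d) : ℝ≥0∞ :=
  ∫⁻ p : ℝ × ℝ,
    ENNReal.ofReal |rankFunction (intervalModule k I) p - rankFunction (intervalModule k J) p|

/-- The zero module, i.e. the class `Δ` of the diagonal. -/
def diagonalPoint (c d : ℝ) : IndexInterval c d := ⟨∅, Set.ordConnected_empty⟩

/-- The cost, for the ground metric `d_rk`, of the partial matching `φ` between two finite
families of intervals; unmatched intervals are matched with the diagonal. -/
def matchingCost {m n : ℕ} (α : Fin m → IndexInterval c d) (β : Fin n → IndexInterval c d)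
    (φ : Fin m ≃. Fin n) : ℝ≥0∞ :=
  (∑ i, match φ i with
    | some j => dRk k (α i) (β j)
    | none => dRk k (α i) (diagonalPoint c d)) +
  ∑ j, match φ.symm j with
    | some _ => 0
    | none => dRk k (diagonalPoint c d) (β j)

variable {k}

/-- The finite family `α` of intervals is a barcode of `M`: `M` is isomorphic to the direct sum of
the interval modules of `α`. -/
def IsBarcode (M : PersistenceModule k c d) {m : ℕ} (α : Fin m → IndexInterval c d) : Prop :=
  (∀ i, (α i).1.Nonempty) ∧ Nonempty (M ≅ ⨁ fun i => intervalModule k (α i))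

/-- `W_1^rk` between (the diagrams of) two persistence modules: the least cost of a partial
matching between their barcodes.  It is `∞` when one of the modules has no finite barcode. -/
def wassersteinRk (M N : PersistenceModule k c d) : ℝ≥0∞ :=
  ⨅ (m : ℕ) (n : ℕ) (α : Fin m → IndexInterval c d) (β : Fin n → IndexInterval c d)
    (_ : IsBarcode M α) (_ : IsBarcode N β) (φ : Fin m ≃. Fin n), matchingCost k α β φ

/-- The interval `{t ∈ [c, d] : x ≤ t}`, the support of the free module generated at `x`. -/
def freeInterval (c d x : ℝ) : IndexInterval c d :=
  ⟨{t | x ≤ (t : ℝ)}, ⟨fun _ hs _ _ _ ht => le_trans (α := ℝ) hs ht.1⟩⟩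

namespace CellComplex

/-- `Dgm_i(w) = H_i(K^w_•; k)`, as a persistence module indexed by `[c, d]`. -/
def persistentHomology (K : CellComplex k) (w : K.Cell →o ℝ) (c d : ℝ) (i : ℕ) :
    PersistenceModule k c d :=
  K.filteredComplex w c d ⋙ HomologicalComplex.homologyFunctor (ModuleCat.{u} k) _ i

/-- `d_rk(I_{w(σ)}, I_{v(σ)})`, for the free modules generated by the cell `σ` in the persistence
modules indexed by `[c, d]`. -/
def cellDist (K : CellComplex k) (w v : K.Cell →o ℝ) (c d : ℝ) (σ : K.Cell) : ℝ≥0∞ :=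
  dRk k (freeInterval c d (w σ)) (freeInterval c d (v σ))

/-- The inequalities of the barcode stability theorem, with persistence parameter in `[c, d]`, in
all degrees together and in each single degree. -/
def BarcodeBound (K : CellComplex k) (w v : K.Cell →o ℝ) (c d : ℝ) : Prop :=
  (∑' i, wassersteinRk (K.persistentHomology w c d i) (K.persistentHomology v c d i) ≤
    ∑ σ, K.cellDist w v c d σ) ∧
  ∀ i, wassersteinRk (K.persistentHomology w c d i) (K.persistentHomology v c d i) ≤
    ∑ σ with K.dim σ = i ∨ K.dim σ = i + 1, K.cellDist w v c d σ

/-- The filtration `t ↦ K^w_t`, `t ∈ [c, d]`, represents the weight `w`: each cell `σ` appears in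
it exactly at the parameter `w(σ)`, so that the free module generated by `σ` is `I_{[w(σ), d]}`. -/
def Represents (K : CellComplex k) (w : K.Cell →o ℝ) (c d : ℝ) : Prop :=
  ∀ σ, IsLeast {t : ℝ | t ∈ Set.Icc c d ∧ σ ∈ K.sublevel w t} (w σ)

end CellComplex

/-- For the complexes of the class `𝒦` and all their weights with values in `[a, b]`, the barcode
stability inequalities hold with persistence parameter in `[c, d]`. -/
def BarcodeStable (𝒦 : Set (CellComplex k)) (a b c d : ℝ) : Prop :=
  ∀ K ∈ 𝒦, ∀ w v : K.Cell →o ℝ, (∀ σ, w σ ∈ Set.Icc a b) → (∀ σ, v σ ∈ Set.Icc a b) →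
    K.BarcodeBound w v c d

/-- The map from filtered complexes indexed by `[c, d]` to diagrams is stable for weights with
values in `[a, b]`: the weights are represented by filtrations indexed by `[c, d]`, and the barcode
stability inequalities hold. -/
def StableOn (𝒦 : Set (CellComplex k)) (a b c d : ℝ) : Prop :=
  (∀ K ∈ 𝒦, ∀ w : K.Cell →o ℝ, (∀ σ, w σ ∈ Set.Icc a b) → K.Represents w c d) ∧
  BarcodeStable 𝒦 a b c d

end Persistence

end

/-! View rank functions in the (r, s)-plane: `dRk` is the area of the symmetric difference of two
rank supports. A bar is born with one cell and may be killed by another. Moving its birth sweeps a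
region that the free module of the birth cell sweeps as well, whatever the window. Moving its death
from y to y' sweeps, at each height u between them, a horizontal slice of length at most u - a,
while the free module of the killing cell sweeps a vertical slice of length d - u. The comparison u
- a ≤ d - u, for all u < b, is the condition 2b - a ≤ d.

Sufficiency. If two weights never order two cells in opposite ways, one enumeration of the cells
sorts both, and Barannikov's normal form (`exists_matching_normal_form`, `exists_normalForm`) gives
a single basis and a single pairing of cells that compute both barcodes (`NormalForm.isBarcode`).
Matching the bars with the same cells proves the inequalities, because each cell is charged as an
end of at most one bar (`sum_dRk_bar_le`, `tsum_charge_le`). For arbitrary weights, follow the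
segment from w to v to the first time at which an inverted pair of cells meets, and induct on the
number of inverted pairs (`hasBoundedMatching`). The costs of the cells add up exactly along the
segment (`dRk_freeInterval_add`), and the matchings compose because barcodes are unique
(`IsPaddedBarcode.exists_perm`).

Necessity. Take an edge with both vertices at a and move the edge from y to y'. The L¹ distance of
rank functions bounds `wassersteinRk` from below and is at least (y - a)(y' - y), while the cells
cost at most (y' - y)(d - y). If a < d < 2b - a, some y beyond the midpoint of [a, d] violates the
inequality (`BarcodeStable.two_mul_sub_le`). Representability forces [a, b] ⊆ [c, d], which leaves
only the degenerate case a = b = d. Optimality of the cell terms holds since a larger window only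
adds area (`dRk_freeInterval_mono`). -/

/-! ### Barannikov reduction of graded triangular matrices. -/

section MatrixReduction

variable {k : Type u} [Field k] {n : ℕ}

/-- Upper triangular matrices that respect the grading `dim` of the basis vectors. -/
def IsGradedTriangular (dim : Fin n → ℕ) (F : Matrix (Fin n) (Fin n) k) : Prop :=
  ∀ i j, F i j ≠ 0 → i ≤ j ∧ dim i = dim j

theorem IsGradedTriangular.one (dim : Fin n → ℕ) :
    IsGradedTriangular dim (1 : Matrix (Fin n) (Fin n) k) := by
  intro i j h
  by_cases hij : i = j
  · exact ⟨hij.le, congrArg dim hij⟩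
  · exact absurd (Matrix.one_apply_ne hij) h

theorem IsGradedTriangular.mul {dim : Fin n → ℕ} {F G : Matrix (Fin n) (Fin n) k}
    (hF : IsGradedTriangular dim F) (hG : IsGradedTriangular dim G) :
    IsGradedTriangular dim (F * G) := by
  intro i j h
  rw [Matrix.mul_apply] at h
  obtain ⟨x, -, hx⟩ := Finset.exists_ne_zero_of_sum_ne_zero h
  have h1 := hF i x (left_ne_zero_of_mul hx)
  have h2 := hG x j (right_ne_zero_of_mul hx)
  exact ⟨h1.1.trans h2.1, h1.2.trans h2.2⟩

theorem IsGradedTriangular.isUnit_det {dim : Fin n → ℕ} {F : Matrix (Fin n) (Fin n) k}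
    (hF : IsGradedTriangular dim F) (hd : ∀ i, F i i ≠ 0) : IsUnit F.det := by
  have hup : F.IsUpperTriangular := by
    intro i j hij
    by_contra h
    exact absurd (hF i j h).1 (not_le.2 hij)
  rw [Matrix.det_of_isUpperTriangular hup]
  exact (Finset.prod_ne_zero_iff.2 fun i _ => hd i).isUnit

/-- The condition amounts to block triangularity for three orders: the index, `dim`, and `dim`
reversed. Each one passes to the inverse, and the last two together give equality of dimensions. -/
theorem IsGradedTriangular.inv {dim : Fin n → ℕ} {F : Matrix (Fin n) (Fin n) k}
    (hF : IsGradedTriangular dim F) (hu : IsUnit F.det) : IsGradedTriangular dim F⁻¹ := by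
  let := F.invertibleOfIsUnitDet hu
  have h1 : (F⁻¹).BlockTriangular (id : Fin n → Fin n) := by
    refine Matrix.blockTriangular_inv_of_blockTriangular fun i j hij => ?_
    by_contra h
    exact absurd (hF i j h).1 (not_le.2 hij)
  have h2 : (F⁻¹).BlockTriangular dim := by
    refine Matrix.blockTriangular_inv_of_blockTriangular fun i j hij => ?_
    by_contra h
    exact absurd (hF i j h).2 (ne_of_gt hij)
  have h3 : (F⁻¹).BlockTriangular (OrderDual.toDual ∘ dim) := by
    refine Matrix.blockTriangular_inv_of_blockTriangular fun i j hij => ?_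
    by_contra h
    exact absurd (hF i j h).2 (ne_of_lt (OrderDual.toDual_lt_toDual.1 hij))
  intro i j h
  refine ⟨?_, le_antisymm ?_ ?_⟩
  · by_contra hij
    exact h (h1 (not_le.1 hij))
  · by_contra hij
    exact h (h2 (not_le.1 hij))
  · by_contra hij
    exact h (h3 (OrderDual.toDual_lt_toDual.2 (not_le.1 hij)))

/-- The partial matching `p` extended by one more pair. -/
def PEquiv.extend {α : Type*} [DecidableEq α] (p : α ≃. α) (a b : α) (ha : p a = none)
    (hb : p.symm b = none) : α ≃. α where
  toFun x := if x = a then some b else p x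
  invFun y := if y = b then some a else p.symm y
  inv x y := by
    by_cases hx : x = a
    · by_cases hy : y = b
      · simp [hx, hy]
      · have : x ∉ p.symm y := fun h => by
          have := p.mem_iff_mem.1 h
          rw [hx, Option.mem_def, ha] at this
          cases this
        have h2 : ¬ b = y := fun h => hy h.symm
        simp only [hx, hy, if_true, if_false, Option.some.injEq, h2, iff_false]
        rwa [← hx]
    · by_cases hy : y = b
      · have : y ∉ p x := fun h => by
          have := p.mem_iff_mem.2 h
          rw [hy, Option.mem_def, hb] at this
          cases this
        have h2 : ¬ a = x := fun h => hx h.symm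
        simp only [hx, hy, if_true, if_false, Option.some.injEq, h2, false_iff]
        rwa [← hy]
      · simp only [hx, hy, if_false]
        exact p.mem_iff_mem

theorem PEquiv.toMatrix_eq_of_mem {α : Type*} [DecidableEq α] (p : α ≃. α) {i j : α}
    (h : p i = some j) : (p.toMatrix : Matrix α α k) i j = 1 := by
  simp [PEquiv.toMatrix_apply, h]

/-- One step of the reduction of a boundary matrix: the first `m` columns are in normal form, and
a change of basis brings column `m` into normal form. -/
theorem exists_reduce_column (dim : Fin n → ℕ) (D : Matrix (Fin n) (Fin n) k)
    (hDD : D * D = 0) (hup : ∀ i j, D i j ≠ 0 → i < j)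
    (hdim : ∀ i j, D i j ≠ 0 → dim j = dim i + 1) (s : Fin n) (p : Fin n ≃. Fin n)
    (hp : ∀ i j, p i = some j → j < s)
    (hcol : ∀ i j, j < s → D i j = p.toMatrix i j) :
    ∃ (F : Matrix (Fin n) (Fin n) k) (p' : Fin n ≃. Fin n),
      IsGradedTriangular dim F ∧ (∀ i, F i i ≠ 0) ∧
      (∀ i j, p' i = some j → j ≤ s) ∧
      ∀ i j, j ≤ s → (D * F) i j = (F * (p'.toMatrix : Matrix (Fin n) (Fin n) k)) i j := by
  have hpD : ∀ i j, p i = some j → D i j = 1 := fun i j h => by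
    rw [hcol i j (hp i j h), PEquiv.toMatrix_eq_of_mem p h]
  have hplt : ∀ i j, p i = some j → i < j := fun i j h =>
    hup i j (by rw [hpD i j h]; exact one_ne_zero)
  have hpdim : ∀ i j, p i = some j → dim j = dim i + 1 := fun i j h =>
    hdim i j (by rw [hpD i j h]; exact one_ne_zero)
  -- Before column `s`, row `i` has at most one nonzero entry, a one at the partner of `i`. Pairing
  -- the row with a vector supported there reads off one coordinate.
  have hrow : ∀ (i : Fin n) (z : Fin n → k), (∀ x, z x ≠ 0 → x < s) →
      ∑ x, D i x * z x = match p i with | some x => z x | none => 0 := by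
    intro i z hz
    have hterm : ∀ x, D i x * z x = if p i = some x then z x else 0 := by
      intro x
      by_cases hx : z x = 0
      · simp [hx]
      · rw [hcol i x (hz x hx), PEquiv.toMatrix_apply]
        simp [Option.mem_def]
    simp_rw [hterm]
    cases h : p i with
    | none => simp
    | some y => simp
  -- Column `s` has no entry in a row that already serves as a death: this is the entry `(i, s)` of
  -- `D * D = 0`.
  have hdeath : ∀ i j, p i = some j → D j s = 0 := by
    intro i j h
    have h0 : (D * D) i s = 0 := by rw [hDD]; rfl
    rw [Matrix.mul_apply, hrow i (fun x => D x s) (fun x hx => hup x s hx), h] at h0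
    exact h0
  -- The combination of earlier columns that clears, in column `s`, every row that already has a
  -- partner.
  set m : Fin n → k := fun x => match p.symm x with | some i => D i s | none => 0 with hm
  have hm_ne : ∀ x, m x ≠ 0 → ∃ i, p i = some x ∧ D i s ≠ 0 := by
    intro x hx
    rw [hm] at hx
    cases h : p.symm x with
    | none => simp [h] at hx
    | some i => exact ⟨i, p.eq_some_iff.1 h, by simpa [h] using hx⟩
  have hm_some : ∀ i x, p i = some x → m x = D i s := by
    intro i x h
    simp only [hm, p.eq_some_iff.2 h]
  have hsymm_s : p.symm s = none := by
    cases h : p.symm s with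
    | none => rfl
    | some i => exact absurd (hp i s (p.eq_some_iff.1 h)) (lt_irrefl s)
  have hm_s : m s = 0 := by simp only [hm, hsymm_s]
  have hp_s : p s = none := by
    cases h : p s with
    | none => rfl
    | some j => exact absurd ((hplt s j h).trans (hp s j h)) (lt_irrefl s)
  have hzsum : ∀ i, ∑ x, D i x * ((if x = s then 1 else 0) - m x) =
      if p i = none then D i s else 0 := by
    intro i
    simp only [mul_sub, Finset.sum_sub_distrib, mul_ite, mul_one, mul_zero, Finset.sum_ite_eq',
      Finset.mem_univ, if_true]
    rw [hrow i m (fun x hx => by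
      obtain ⟨j, hj, -⟩ := hm_ne x hx
      exact hp j x hj)]
    cases h : p i with
    | none => simp
    | some y => simp [hm_some i y h]
  -- Does column `s` survive the clearing? If so, its lowest remaining entry `t` becomes the partner
  -- of `s`; otherwise the cleared vector is a new cycle.
  by_cases hS : ∃ i, D i s ≠ 0 ∧ p i = none
  · obtain ⟨t, ⟨htD, htp⟩, htmax⟩ : ∃ t, (D t s ≠ 0 ∧ p t = none) ∧
        ∀ i, (D i s ≠ 0 ∧ p i = none) → i ≤ t := by
      classical
      have hne : (Finset.univ.filter fun i => D i s ≠ 0 ∧ p i = none).Nonempty := by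
        obtain ⟨i, hi⟩ := hS
        exact ⟨i, by simpa using hi⟩
      refine ⟨_, by simpa using Finset.max'_mem _ hne, fun i hi => Finset.le_max' _ i ?_⟩
      simpa using hi
    have hts : t < s := hup t s htD
    have hsymm_t : p.symm t = none := by
      cases h : p.symm t with
      | none => rfl
      | some i => exact absurd (hdeath i t (p.eq_some_iff.1 h)) htD
    -- The new vector at `s` is the cleared one, and the new vector at `t` is its image under `D`.
    -- Maximality of `t` makes this image triangular, with diagonal entry `D t s ≠ 0`.
    let F : Matrix (Fin n) (Fin n) k := fun x j =>
      if j = s then (if x = s then 1 else 0) - m x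
      else if j = t then (if p x = none then D x s else 0)
      else if x = j then 1 else 0
    have hFs : ∀ x, F x s = (if x = s then 1 else 0) - m x := fun x => by simp [F]
    have hFt : ∀ x, F x t = if p x = none then D x s else 0 := fun x => by simp [F, hts.ne]
    have hFo : ∀ x j, j ≠ s → j ≠ t → F x j = if x = j then 1 else 0 := fun x j h1 h2 => by
      simp [F, h1, h2]
    refine ⟨F, p.extend t s htp hsymm_s, ?_, ?_, ?_, ?_⟩
    · intro i j h
      by_cases hjs : j = s
      · subst hjs
        rw [hFs] at h
        by_cases hij : i = j
        · exact ⟨hij.le, congrArg dim hij⟩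
        · rw [if_neg hij, zero_sub, neg_ne_zero] at h
          obtain ⟨l, hl, hlD⟩ := hm_ne i h
          exact ⟨(hp l i hl).le, (hpdim l i hl).trans (hdim l j hlD).symm⟩
      · by_cases hjt : j = t
        · subst hjt
          rw [hFt] at h
          have h' : p i = none ∧ D i s ≠ 0 := by
            by_cases hpi : p i = none
            · exact ⟨hpi, by simpa [hpi] using h⟩
            · simp [hpi] at h
          refine ⟨htmax i h'.symm, ?_⟩
          have h1 := hdim i s h'.2
          have h2 := hdim j s htD
          omega
        · rw [hFo i j hjs hjt] at h
          by_cases hij : i = j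
          · exact ⟨hij.le, congrArg dim hij⟩
          · simp [hij] at h
    · intro i
      by_cases his : i = s
      · subst his
        simp [hFs, hm_s]
      · by_cases hit : i = t
        · subst hit
          simp [hFt, htp, htD]
        · simp [hFo i i his hit]
    · intro i j h
      change (if i = t then some s else p i) = some j at h
      split_ifs at h with hi
      · exact (Option.some.inj h).symm.le
      · exact (hp i j h).le
    · intro i j hj
      rw [PEquiv.mul_toMatrix_apply, Matrix.mul_apply]
      change _ = Option.casesOn (motive := fun _ => k) (if j = s then some t else p.symm j) 0 (F i)
      by_cases hjs : j = s
      · subst hjs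
        simp only [if_true, hFs, hFt]
        exact hzsum i
      · rw [if_neg hjs]
        have hjlt : j < s := lt_of_le_of_ne hj hjs
        by_cases hjt : j = t
        -- The new vector at `t` is a boundary, so `D` must kill it; its entries avoid the death
        -- rows by `hdeath`.
        · subst hjt
          rw [hsymm_t]
          simp only [hFt]
          rw [hrow i (fun x => if p x = none then D x s else 0) (fun x hx => by
            by_cases hpx : p x = none
            · exact hup x s (by simpa [hpx] using hx)
            · simp [hpx] at hx)]
          cases h : p i with
          | none => rfl
          | some y => simp [hdeath i y h]
        · simp only [hFo _ j hjs hjt, mul_ite, mul_one, mul_zero, Finset.sum_ite_eq',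
            Finset.mem_univ, if_true]
          rw [hcol i j hjlt, PEquiv.toMatrix_apply]
          cases h : p.symm j with
          | none =>
            rw [if_neg]
            intro h'
            have := p.mem_iff_mem.2 h'
            rw [Option.mem_def, h] at this
            cases this
          | some l =>
            have hl : p l = some j := p.eq_some_iff.1 h
            have hls : l ≠ s := by
              rintro rfl
              rw [hp_s] at hl
              cases hl
            have hlt : l ≠ t := by
              rintro rfl
              rw [htp] at hl
              cases hl
            simp only [hFo i l hls hlt]
            refine if_congr ⟨fun h' => ?_, fun h' => ?_⟩ rfl rfl
            · exact p.inj h' hl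
            · rw [h']
              exact hl
  -- Every entry of column `s` is cleared, so the pairing stays as it is.
  · push Not at hS
    let F : Matrix (Fin n) (Fin n) k := fun x j =>
      if j = s then (if x = s then 1 else 0) - m x else if x = j then 1 else 0
    have hFs : ∀ x, F x s = (if x = s then 1 else 0) - m x := fun x => by simp [F]
    have hFo : ∀ x j, j ≠ s → F x j = if x = j then 1 else 0 := fun x j h1 => by
      simp [F, h1]
    refine ⟨F, p, ?_, ?_, fun i j h => (hp i j h).le, ?_⟩
    · intro i j h
      by_cases hjs : j = s
      · subst hjs
        rw [hFs] at h
        by_cases hij : i = j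
        · exact ⟨hij.le, congrArg dim hij⟩
        · rw [if_neg hij, zero_sub, neg_ne_zero] at h
          obtain ⟨l, hl, hlD⟩ := hm_ne i h
          exact ⟨(hp l i hl).le, (hpdim l i hl).trans (hdim l j hlD).symm⟩
      · rw [hFo i j hjs] at h
        by_cases hij : i = j
        · exact ⟨hij.le, congrArg dim hij⟩
        · simp [hij] at h
    · intro i
      by_cases his : i = s
      · subst his
        simp [hFs, hm_s]
      · simp [hFo i i his]
    · intro i j hj
      rw [PEquiv.mul_toMatrix_apply, Matrix.mul_apply]
      by_cases hjs : j = s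
      · subst hjs
        simp only [hsymm_s, hFs]
        rw [hzsum i]
        split_ifs with h
        · by_contra h'
          exact hS i h' h
        · rfl
      · have hjlt : j < s := lt_of_le_of_ne hj hjs
        simp only [hFo _ j hjs, mul_ite, mul_one, mul_zero, Finset.sum_ite_eq',
            Finset.mem_univ, if_true]
        rw [hcol i j hjlt, PEquiv.toMatrix_apply]
        cases h : p.symm j with
        | none =>
          rw [if_neg]
          intro h'
          have := p.mem_iff_mem.2 h'
          rw [Option.mem_def, h] at this
          cases this
        | some l =>
          have hl : p l = some j := p.eq_some_iff.1 h
          have hls : l ≠ s := by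
            rintro rfl
            rw [hp_s] at hl
            cases hl
          simp only [hFo i l hls]
          refine if_congr ⟨fun h' => ?_, fun h' => ?_⟩ rfl rfl
          · exact p.inj h' hl
          · rw [h']
            exact hl

/-- Barannikov normal form: a graded, strictly upper triangular matrix of square zero is conjugate,
by a graded triangular matrix, to the matrix of a partial matching. -/
theorem exists_matching_normal_form (dim : Fin n → ℕ) (D : Matrix (Fin n) (Fin n) k)
    (hDD : D * D = 0) (hup : ∀ i j, D i j ≠ 0 → i < j)
    (hdim : ∀ i j, D i j ≠ 0 → dim j = dim i + 1) :
    ∃ (F G : Matrix (Fin n) (Fin n) k) (p : Fin n ≃. Fin n),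
      IsGradedTriangular dim F ∧ IsGradedTriangular dim G ∧ F * G = 1 ∧
      G * D * F = p.toMatrix := by
  suffices H : ∀ m ≤ n, ∃ (F G : Matrix (Fin n) (Fin n) k) (p : Fin n ≃. Fin n),
      IsGradedTriangular dim F ∧ IsGradedTriangular dim G ∧ F * G = 1 ∧
      (∀ i j, p i = some j → (j : ℕ) < m) ∧
      ∀ i j : Fin n, (j : ℕ) < m → (G * D * F) i j = p.toMatrix i j by
    obtain ⟨F, G, p, hF, hG, h1, -, h2⟩ := H n le_rfl
    exact ⟨F, G, p, hF, hG, h1, by ext i j; exact h2 i j j.2⟩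
  intro m
  induction m with
  | zero =>
    intro _
    exact ⟨1, 1, ⊥, .one dim, .one dim, one_mul 1, by simp, by simp⟩
  | succ m ih =>
    intro hm
    obtain ⟨F, G, p, hF, hG, hFG, hp, hcol⟩ := ih (by omega)
    have hGF : G * F = 1 := mul_eq_one_comm.1 hFG
    have hchain : ∀ i j, (G * D * F) i j ≠ 0 → i < j ∧ dim j = dim i + 1 := by
      intro i j h
      rw [Matrix.mul_apply] at h
      obtain ⟨y, -, hy⟩ := Finset.exists_ne_zero_of_sum_ne_zero h
      have hy1 := left_ne_zero_of_mul hy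
      have hy2 := hF y j (right_ne_zero_of_mul hy)
      rw [Matrix.mul_apply] at hy1
      obtain ⟨x, -, hx⟩ := Finset.exists_ne_zero_of_sum_ne_zero hy1
      have hx1 := hG i x (left_ne_zero_of_mul hx)
      have hx2 := right_ne_zero_of_mul hx
      have h3 := hup x y hx2
      have h4 := hdim x y hx2
      exact ⟨hx1.1.trans_lt (h3.trans_le hy2.1), by omega⟩
    have hsq : (G * D * F) * (G * D * F) = 0 := by
      calc (G * D * F) * (G * D * F) = G * D * (F * G) * D * F := by simp only [Matrix.mul_assoc]
        _ = G * (D * D) * F := by rw [hFG, Matrix.mul_one]; simp only [Matrix.mul_assoc]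
        _ = 0 := by rw [hDD, Matrix.mul_zero, Matrix.zero_mul]
    obtain ⟨E, q, hE, hEd, hq, hEcol⟩ := exists_reduce_column dim (G * D * F) hsq
      (fun i j h => (hchain i j h).1) (fun i j h => (hchain i j h).2) ⟨m, by omega⟩ p
      (fun i j h => hp i j h) (fun i j h => hcol i j h)
    have hu := hE.isUnit_det hEd
    have hEE : E * E⁻¹ = 1 := Matrix.mul_nonsing_inv E hu
    have hEE' : E⁻¹ * E = 1 := Matrix.nonsing_inv_mul E hu
    refine ⟨F * E, E⁻¹ * G, q, hF.mul hE, (hE.inv hu).mul hG, ?_,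
      fun i j h => Nat.lt_succ_of_le (hq i j h), ?_⟩
    · calc F * E * (E⁻¹ * G) = F * (E * E⁻¹) * G := by simp only [Matrix.mul_assoc]
        _ = 1 := by rw [hEE, Matrix.mul_one, hFG]
    · intro i j hj
      -- Multiplying on the left by `E⁻¹` acts on each column separately, so knowing the columns up
      -- to `m` of the product with `E` is enough.
      have h1 : E⁻¹ * G * D * (F * E) = E⁻¹ * (G * D * F * E) := by simp only [Matrix.mul_assoc]
      have h2 : (E⁻¹ * (E * q.toMatrix) : Matrix (Fin n) (Fin n) k) = q.toMatrix := by
        rw [← Matrix.mul_assoc, hEE', Matrix.one_mul]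
      rw [h1, ← h2, Matrix.mul_apply, Matrix.mul_apply]
      exact Finset.sum_congr rfl fun x _ => by rw [hEcol x j (Nat.le_of_lt_succ hj)]

end MatrixReduction

/-! ### Normal forms of the boundary operator of a cell complex. -/

namespace CellComplex

variable {k : Type u} [Field k]

/-- A basis `F` of the chains of `K`, with coordinate functionals `coord`, which the boundary
operator matches up: `∂ F σ = F τ` if `p τ = σ`, and `∂ F σ = 0` if `σ` is not in the image
of `p`. -/
structure NormalForm (K : CellComplex k) where
  F : K.Cell → K.Cell → k
  coord : K.Cell → (K.Cell → k) →ₗ[k] k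
  p : K.Cell ≃. K.Cell
  coord_self : ∀ σ, coord σ (F σ) = 1
  coord_ne : ∀ σ τ, τ ≠ σ → coord τ (F σ) = 0
  sum_coord : ∀ c, ∑ τ, coord τ c • F τ = c
  boundary_of_some : ∀ σ τ, p τ = some σ → K.boundary (F σ) = F τ
  boundary_of_none : ∀ σ, p.symm σ = none → K.boundary (F σ) = 0
  dim_of_F : ∀ σ τ, F σ τ ≠ 0 → K.dim τ = K.dim σ
  dim_of_coord : ∀ τ c, coord τ c ≠ 0 → ∃ σ, c σ ≠ 0 ∧ K.dim σ = K.dim τ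

/-- The basis is adapted to the sublevel filtration of `w`. -/
structure NormalForm.IsAdapted {K : CellComplex k} (N : K.NormalForm) (w : K.Cell →o ℝ) :
    Prop where
  le_of_F : ∀ σ τ, N.F σ τ ≠ 0 → w τ ≤ w σ
  le_of_coord : ∀ τ c, N.coord τ c ≠ 0 → ∃ σ, c σ ≠ 0 ∧ w τ ≤ w σ

namespace NormalForm

variable {K : CellComplex k} (N : K.NormalForm)

theorem F_ne_zero (σ : K.Cell) : N.F σ ≠ 0 := by
  intro h
  have := N.coord_self σ
  rw [h, map_zero] at this
  exact zero_ne_one this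

theorem symm_of_some {σ τ : K.Cell} (h : N.p τ = some σ) : N.p.symm σ = some τ :=
  N.p.eq_some_iff.2 h

theorem p_of_symm {σ τ : K.Cell} (h : N.p.symm σ = some τ) : N.p τ = some σ :=
  N.p.eq_some_iff.1 h

/-- The boundary sends each basis chain to zero or to a basis chain, distinct ones having distinct
nonzero images; only the component of `c` along `F σ` contributes to `F τ`. -/
theorem coord_boundary_of_some {σ τ : K.Cell} (h : N.p τ = some σ) (c : K.Cell → k) :
    N.coord τ (K.boundary c) = N.coord σ c := by
  conv_lhs => rw [← N.sum_coord c]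
  rw [map_sum, map_sum, Finset.sum_eq_single σ]
  · rw [map_smul, map_smul, N.boundary_of_some σ τ h, N.coord_self, smul_eq_mul, mul_one]
  · intro ρ _ hρ
    rw [map_smul, map_smul]
    cases h' : N.p.symm ρ with
    | none => rw [N.boundary_of_none ρ h', map_zero, smul_zero]
    | some τ' =>
      have h1 := N.p_of_symm h'
      rw [N.boundary_of_some ρ τ' h1, N.coord_ne, smul_zero]
      rintro rfl
      rw [h] at h1
      exact hρ (Option.some.inj h1).symm
  · intro h
    exact absurd (Finset.mem_univ σ) h

theorem coord_boundary_of_none {τ : K.Cell} (h : N.p τ = none) (c : K.Cell → k) :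
    N.coord τ (K.boundary c) = 0 := by
  conv_lhs => rw [← N.sum_coord c]
  rw [map_sum, map_sum]
  refine Finset.sum_eq_zero fun ρ _ => ?_
  rw [map_smul, map_smul]
  cases h' : N.p.symm ρ with
  | none => rw [N.boundary_of_none ρ h', map_zero, smul_zero]
  | some τ' =>
    have h1 := N.p_of_symm h'
    rw [N.boundary_of_some ρ τ' h1, N.coord_ne, smul_zero]
    rintro rfl
    rw [h] at h1
    cases h1

theorem coord_of_cycle {σ τ : K.Cell} (h : N.p τ = some σ) {c : K.Cell → k}
    (hc : K.boundary c = 0) : N.coord σ c = 0 := by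
  rw [← N.coord_boundary_of_some h, hc, map_zero]

theorem p_of_death {σ τ : K.Cell} (h : N.p τ = some σ) : N.p σ = none := by
  cases h' : N.p σ with
  | none => rfl
  | some ρ =>
    have h1 := N.boundary_of_some σ τ h
    have h2 := N.boundary_of_some ρ σ h'
    rw [← h2, K.boundary_boundary] at h1
    exact absurd h1.symm (N.F_ne_zero τ)

/-- Since `F τ` is the nonzero boundary of `F σ`, their supports contain an incident pair of cells.
This transfers the degree of `inc` to the pairing. -/
theorem exists_inc {σ τ : K.Cell} (h : N.p τ = some σ) :
    ∃ ρ, N.F σ ρ ≠ 0 ∧ ∃ π, K.inc ρ π ≠ 0 ∧ N.F τ π ≠ 0 := by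
  obtain ⟨π, hπ⟩ := Function.ne_iff.1 (N.F_ne_zero τ)
  have h1 : K.boundary (N.F σ) π ≠ 0 := by
    rw [N.boundary_of_some σ τ h]
    exact hπ
  obtain ⟨ρ, -, hρ⟩ := Finset.exists_ne_zero_of_sum_ne_zero h1
  exact ⟨ρ, left_ne_zero_of_mul hρ, π, right_ne_zero_of_mul hρ, hπ⟩

theorem dim_of_some {σ τ : K.Cell} (h : N.p τ = some σ) : K.dim σ = K.dim τ + 1 := by
  obtain ⟨ρ, hρ, π, hπ, hτ⟩ := N.exists_inc h
  rw [← N.dim_of_F σ ρ hρ, ← N.dim_of_F τ π hτ, K.dim_of_inc ρ π hπ]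

end NormalForm

theorem exists_sorted_equiv {α β : Type*} [Fintype α] [LinearOrder β] (f : α → β) :
    ∃ e : α ≃ Fin (Fintype.card α), ∀ x y, f x < f y → e x < e y := by
  let e₀ := Fintype.equivFin α
  let g := Tuple.sort (f ∘ e₀.symm)
  refine ⟨e₀.trans g.symm, fun x y hxy => ?_⟩
  by_contra h
  have h1 := Tuple.monotone_sort (f ∘ e₀.symm) (not_lt.1 h)
  simp only [Function.comp, Equiv.trans_apply] at h1
  change f (e₀.symm (g (g.symm (e₀ y)))) ≤ f (e₀.symm (g (g.symm (e₀ x)))) at h1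
  simp only [Equiv.apply_symm_apply, Equiv.symm_apply_apply] at h1
  exact absurd hxy (not_lt.2 h1)

/-- A normal form compatible with a given enumeration of the cells. -/
theorem exists_normalForm_of_equiv (K : CellComplex k) {n : ℕ} (e : K.Cell ≃ Fin n)
    (he : ∀ σ τ, K.inc σ τ ≠ 0 → e τ < e σ) :
    ∃ N : K.NormalForm, (∀ σ τ, N.F σ τ ≠ 0 → e τ ≤ e σ) ∧
      ∀ τ c, N.coord τ c ≠ 0 → ∃ σ, c σ ≠ 0 ∧ e τ ≤ e σ := by
  -- Columns are boundaries of cells, so `D` is the transpose of `inc` and the factors in `inc_inc`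
  -- get swapped.
  let D : Matrix (Fin n) (Fin n) k := fun i j => K.inc (e.symm j) (e.symm i)
  have hDD : D * D = 0 := by
    ext i j
    rw [Matrix.mul_apply]
    have := K.inc_inc (e.symm j) (e.symm i)
    rw [← Equiv.sum_comp e.symm] at this
    rw [Matrix.zero_apply, ← this]
    exact Finset.sum_congr rfl fun x _ => mul_comm _ _
  obtain ⟨F, G, p, hF, hG, hFG, hconj⟩ := exists_matching_normal_form (fun i => K.dim (e.symm i)) D
    hDD (fun i j h => by simpa using he _ _ h) (fun i j h => K.dim_of_inc _ _ h)
  have hGF : G * F = 1 := mul_eq_one_comm.1 hFG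
  have hDF : D * F = F * p.toMatrix := by
    rw [← hconj, Matrix.mul_assoc G D F, ← Matrix.mul_assoc F G, hFG, Matrix.one_mul]
  let q : K.Cell ≃. K.Cell := (e.toPEquiv.trans p).trans e.symm.toPEquiv
  have hq : ∀ σ τ, q τ = some σ ↔ p (e τ) = some (e σ) := by
    intro σ τ
    have : q τ = (p (e τ)).bind fun x => some (e.symm x) := rfl
    rw [this]
    cases h : p (e τ) with
    | none => simp
    | some x => simp [Equiv.symm_apply_eq]
  have hbd : ∀ σ ρ, K.boundary (fun τ => F (e τ) (e σ)) ρ = (F * (p.toMatrix : Matrix (Fin n) (Fin n) k)) (e ρ) (e σ) := by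
    intro σ ρ
    rw [← hDF, Matrix.mul_apply, ← Equiv.sum_comp e]
    change ∑ x, F (e x) (e σ) * K.inc x ρ = _
    exact Finset.sum_congr rfl fun x _ => by simp [D, mul_comm]
  let cd : K.Cell → (K.Cell → k) →ₗ[k] k := fun τ =>
    { toFun := fun c => ∑ σ, G (e τ) (e σ) * c σ
      map_add' := fun c c' => by simp [mul_add, Finset.sum_add_distrib]
      map_smul' := fun r c => by simp [Finset.mul_sum, mul_left_comm] }
  have hcd : ∀ τ c, cd τ c = ∑ σ, G (e τ) (e σ) * c σ := fun _ _ => rfl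
  have hcdF : ∀ τ σ, cd τ (fun ρ => F (e ρ) (e σ)) = (1 : Matrix (Fin n) (Fin n) k) (e τ) (e σ) := by
    intro τ σ
    rw [← hGF, Matrix.mul_apply, ← Equiv.sum_comp e]
    rfl
  have hex : ∀ τ c, cd τ c ≠ 0 → ∃ σ, c σ ≠ 0 ∧ G (e τ) (e σ) ≠ 0 := by
    intro τ c h
    obtain ⟨σ, -, hσ⟩ := Finset.exists_ne_zero_of_sum_ne_zero h
    exact ⟨σ, right_ne_zero_of_mul hσ, left_ne_zero_of_mul hσ⟩
  refine ⟨⟨fun σ τ => F (e τ) (e σ), cd, q, ?_, ?_, ?_, ?_, ?_, ?_, ?_⟩, ?_, ?_⟩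
  · intro σ
    rw [hcdF, Matrix.one_apply_eq]
  · intro σ τ h
    rw [hcdF, Matrix.one_apply_ne fun h' => h (e.injective h')]
  · intro c
    ext ρ
    rw [Finset.sum_apply]
    simp only [Pi.smul_apply, smul_eq_mul, hcd, Finset.sum_mul]
    rw [Finset.sum_comm]
    have : ∀ σ, ∑ τ, G (e τ) (e σ) * c σ * F (e ρ) (e τ) =
        (1 : Matrix (Fin n) (Fin n) k) (e ρ) (e σ) * c σ := by
      intro σ
      rw [← hFG, Matrix.mul_apply, Finset.sum_mul, ← Equiv.sum_comp e]
      exact Finset.sum_congr rfl fun τ _ => by ring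
    simp only [this]
    rw [Finset.sum_eq_single ρ]
    · rw [Matrix.one_apply_eq, one_mul]
    · intro σ _ hσ
      rw [Matrix.one_apply_ne fun h' => hσ (e.injective h').symm, zero_mul]
    · intro h
      exact absurd (Finset.mem_univ ρ) h
  · intro σ τ h
    ext ρ
    rw [hbd, PEquiv.mul_toMatrix_apply, p.eq_some_iff.2 ((hq σ τ).1 h)]
  · intro σ h
    ext ρ
    rw [hbd, PEquiv.mul_toMatrix_apply]
    cases h' : p.symm (e σ) with
    | none => rfl
    | some x =>
      exfalso
      have h1 : q (e.symm x) = some σ := (hq _ _).2 (by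
        rw [Equiv.apply_symm_apply]
        exact p.eq_some_iff.1 h')
      rw [q.eq_some_iff.2 h1] at h
      cases h
  · intro σ τ h
    simpa using (hF _ _ h).2
  · intro τ c h
    obtain ⟨σ, hσ, hG'⟩ := hex τ c h
    exact ⟨σ, hσ, by simpa using (hG _ _ hG').2.symm⟩
  · intro σ τ h
    exact (hF _ _ h).1
  · intro τ c h
    obtain ⟨σ, hσ, hG'⟩ := hex τ c h
    exact ⟨σ, hσ, (hG _ _ hG').1⟩

/-- Two weights that do not order any two cells in opposite ways have a common adapted normal
form. -/
theorem exists_normalForm (K : CellComplex k) (w v : K.Cell →o ℝ)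
    (h : ∀ σ τ, w σ < w τ → v σ ≤ v τ) :
    ∃ N : K.NormalForm, N.IsAdapted w ∧ N.IsAdapted v := by
  -- A strict increase of one weight excludes a decrease of the other, so sorting by the sum sorts
  -- both. The dimension breaks ties and puts faces first.
  obtain ⟨e, he⟩ := exists_sorted_equiv
    (fun σ : K.Cell => toLex ((w σ + v σ, K.dim σ) : ℝ × ℕ))
  have h1 : ∀ σ τ, w σ < w τ → e σ < e τ := fun σ τ h' =>
    he σ τ (Prod.Lex.toLex_lt_toLex.2 (Or.inl (add_lt_add_of_lt_of_le h' (h σ τ h'))))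
  have h2 : ∀ σ τ, v σ < v τ → e σ < e τ := fun σ τ h' =>
    he σ τ (Prod.Lex.toLex_lt_toLex.2 (Or.inl (add_lt_add_of_le_of_lt (by
      by_contra h''
      exact absurd (h τ σ (not_le.1 h'')) (not_le.2 h')) h')))
  obtain ⟨N, hF, hG⟩ := K.exists_normalForm_of_equiv e (fun σ τ hi => by
    have hle := K.face_of_inc σ τ hi
    refine he τ σ (Prod.Lex.toLex_lt_toLex.2 ?_)
    have hd := K.dim_of_inc σ τ hi
    rcases (add_le_add (w.monotone hle) (v.monotone hle)).lt_or_eq with hlt | heq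
    · exact Or.inl hlt
    · exact Or.inr ⟨heq, by simp only; omega⟩)
  refine ⟨N, ⟨fun σ τ hn => ?_, fun τ c hn => ?_⟩, ⟨fun σ τ hn => ?_, fun τ c hn => ?_⟩⟩
  · by_contra hlt
    exact absurd (hF σ τ hn) (not_le.2 (h1 _ _ (not_le.1 hlt)))
  · obtain ⟨σ, hσ, hle⟩ := hG τ c hn
    refine ⟨σ, hσ, ?_⟩
    by_contra hlt
    exact absurd hle (not_le.2 (h1 _ _ (not_le.1 hlt)))
  · by_contra hlt
    exact absurd (hF σ τ hn) (not_le.2 (h2 _ _ (not_le.1 hlt)))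
  · obtain ⟨σ, hσ, hle⟩ := hG τ c hn
    refine ⟨σ, hσ, ?_⟩
    by_contra hlt
    exact absurd hle (not_le.2 (h2 _ _ (not_le.1 hlt)))

end CellComplex

/-! ### From a normal form to a barcode of persistent homology. -/

/-- Only the projections need to be natural; the sections are pointwise, because a natural
transformation that is invertible at each object is an isomorphism. -/
theorem nonempty_iso_biproduct {C : Type*} [Category* C] {k : Type u} [Field k]
    [HasFiniteBiproducts (C ⥤ ModuleCat.{u} k)] {m : ℕ} (M : C ⥤ ModuleCat.{u} k)
    (A : Fin m → C ⥤ ModuleCat.{u} k) (π : ∀ j, M ⟶ A j) (ι : ∀ j t, (A j).obj t ⟶ M.obj t)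
    (htotal : ∀ t, ∑ j, (π j).app t ≫ ι j t = 𝟙 (M.obj t))
    (hself : ∀ t j, ι j t ≫ (π j).app t = 𝟙 ((A j).obj t))
    (hne : ∀ t j l, j ≠ l → ι j t ≫ (π l).app t = 0) : Nonempty (M ≅ ⨁ A) := by
  let Φ : M ⟶ ⨁ A := biproduct.lift π
  have hΦπ : ∀ t j, Φ.app t ≫ (biproduct.π A j).app t = (π j).app t := by
    intro t j
    rw [← NatTrans.comp_app, biproduct.lift_π]
  have htot : ∀ t, ∑ j, (biproduct.π A j).app t ≫ (biproduct.ι A j).app t = 𝟙 ((⨁ A).obj t) := by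
    intro t
    have h := congrArg (fun f => NatTrans.app f t) (biproduct.total (f := A))
    simpa only [NatTrans.app_sum, NatTrans.comp_app, NatTrans.id_app] using h
  have hiso : ∀ t, IsIso (Φ.app t) := by
    intro t
    let Ψ : (⨁ A).obj t ⟶ M.obj t := ∑ j, (biproduct.π A j).app t ≫ ι j t
    have h1 : Φ.app t ≫ Ψ = 𝟙 _ := by
      simp only [Ψ, Preadditive.comp_sum]
      simp only [← Category.assoc, hΦπ]
      exact htotal t
    have h2 : ∀ j, Ψ ≫ Φ.app t ≫ (biproduct.π A j).app t = (biproduct.π A j).app t := by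
      intro j
      rw [hΦπ]
      simp only [Ψ, Preadditive.sum_comp, Category.assoc]
      rw [Finset.sum_eq_single j]
      · rw [hself, Category.comp_id]
      · intro l _ hl
        rw [hne t l j hl, comp_zero]
      · intro h
        exact absurd (Finset.mem_univ j) h
    refine ⟨Ψ, h1, ?_⟩
    rw [← Category.comp_id (Ψ ≫ Φ.app t), ← htot t]
    simp only [Preadditive.comp_sum]
    refine Finset.sum_congr rfl fun j _ => ?_
    rw [← Category.assoc, Category.assoc Ψ, h2]
  have : IsIso Φ := NatIso.isIso_of_isIso_app Φ
  exact ⟨asIso Φ⟩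

namespace CellComplex

variable {k : Type u} [Field k] {K : CellComplex k}

theorem chainComplex_d_apply (w : K.Cell →o ℝ) (t : ℝ) (i : ℕ) (x : K.chains w t (i + 1)) :
    (((K.chainComplex w t).d (i + 1) i).hom x : K.chains w t i).1 = K.boundary x.1 := by
  simp only [chainComplex, ChainComplex.of_d]
  rfl

theorem boundary_eq_zero_of_dim_zero (w : K.Cell →o ℝ) (t : ℝ) {x : K.Cell → k}
    (hx : x ∈ K.chains w t 0) : K.boundary x = 0 := by
  ext τ
  refine Finset.sum_eq_zero fun σ _ => ?_
  by_contra h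
  have h1 := (hx σ (left_ne_zero_of_mul h)).2
  have h2 := K.dim_of_inc σ τ (right_ne_zero_of_mul h)
  omega

namespace NormalForm

variable (N : K.NormalForm) (w : K.Cell →o ℝ) (c d : ℝ) (i : ℕ)

/-- The interval of parameters at which the class of `N.F τ` is nonzero in `H_i`. -/
def bar (τ : K.Cell) : IndexInterval c d :=
  ⟨{t | K.dim τ = i ∧ N.p.symm τ = none ∧ w τ ≤ t ∧ ∀ σ, N.p τ = some σ → (t : ℝ) < w σ},
    ⟨fun _ hr _ hs _ ht => ⟨hr.1, hr.2.1, le_trans (α := ℝ) hr.2.2.1 ht.1,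
      fun σ hσ => lt_of_le_of_lt (α := ℝ) ht.2 (hs.2.2.2 σ hσ)⟩⟩⟩

variable {N w c d i}

theorem smul_F_mem_chains (hN : N.IsAdapted w) {t : Set.Icc c d} {τ : K.Cell}
    (x : intervalFiber k (N.bar w c d i τ) t) : x.1 • N.F τ ∈ K.chains w t i := by
  intro σ hσ
  have hx : x.1 ≠ 0 := left_ne_zero_of_mul hσ
  have ht : t ∈ (N.bar w c d i τ).1 := by
    by_contra h
    exact hx (x.2 h)
  have hF : N.F τ σ ≠ 0 := right_ne_zero_of_mul hσ
  exact ⟨(hN.le_of_F τ σ hF).trans ht.2.2.1, (N.dim_of_F τ σ hF).trans ht.1⟩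

/-- The cycle that generates the class of a bar. -/
noncomputable def barCycle (hN : N.IsAdapted w) (t : Set.Icc c d) (τ : K.Cell) :
    ModuleCat.of k (intervalFiber k (N.bar w c d i τ) t) ⟶ (K.chainComplex w t).X i :=
  ModuleCat.ofHom (Y := K.chains w t i)
    { toFun := fun x => ⟨x.1 • N.F τ, smul_F_mem_chains hN x⟩
      map_add' := fun _ _ => Subtype.ext (add_smul _ _ _)
      map_smul' := fun _ _ => Subtype.ext (mul_smul _ _ _) }

theorem barCycle_d (hN : N.IsAdapted w) (t : Set.Icc c d) (τ : K.Cell) (j : ℕ) :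
    barCycle (i := i) hN t τ ≫ (K.chainComplex w t).d i j = 0 := by
  by_cases hij : i = j + 1
  · subst hij
    ext x
    refine Subtype.ext ?_
    refine (chainComplex_d_apply w t j _).trans ?_
    change K.boundary (x.1 • N.F τ) = 0
    rw [map_smul]
    by_cases ht : t ∈ (N.bar w c d (j + 1) τ).1
    · rw [N.boundary_of_none τ ht.2.1, smul_zero]
    · rw [x.2 ht, zero_smul]
  · rw [(K.chainComplex w t).shape i j fun h => hij h.symm, comp_zero]

theorem coord_eq_zero_of_lt (hN : N.IsAdapted w) {t : ℝ} {τ : K.Cell} (ht : t < w τ)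
    {x : K.Cell → k} (hx : x ∈ K.chains w t i) : N.coord τ x = 0 := by
  by_contra h
  obtain ⟨σ, hσ, hle⟩ := hN.le_of_coord τ x h
  exact absurd (hle.trans (hx σ hσ).1) (not_le.2 ht)

theorem coord_eq_zero_of_dim_ne {t : ℝ} {τ : K.Cell} (ht : K.dim τ ≠ i)
    {x : K.Cell → k} (hx : x ∈ K.chains w t i) : N.coord τ x = 0 := by
  by_contra h
  obtain ⟨σ, hσ, hdim⟩ := N.dim_of_coord τ x h
  exact ht (hdim.symm.trans (hx σ hσ).2)

open Classical in
variable (N w i) in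
/-- The coordinate of a chain along the generator of a bar. -/
noncomputable def barCoord (t : Set.Icc c d) (τ : K.Cell) :
    (K.chainComplex w t).X i ⟶ ModuleCat.of k (intervalFiber k (N.bar w c d i τ) t) :=
  ModuleCat.ofHom (X := K.chains w t i)
    { toFun := fun x => ⟨if t ∈ (N.bar w c d i τ).1 then N.coord τ x.1 else 0,
        fun h => if_neg h⟩
      map_add' := fun _ _ => Subtype.ext (by
        change (if _ then _ else _) = (if _ then _ else _) + (if _ then _ else _)
        split_ifs
        · exact map_add _ _ _
        · exact (add_zero 0).symm)
      map_smul' := fun r x => Subtype.ext (by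
        change (if _ then _ else _) = r • (if _ then _ else _)
        split_ifs
        · exact map_smul _ _ _
        · exact (smul_zero r).symm) }

open Classical in
theorem barCoord_apply (t : Set.Icc c d) (τ : K.Cell) (x : K.chains w t i) :
    ((N.barCoord w i t τ).hom x).1 = if t ∈ (N.bar w c d i τ).1 then N.coord τ x.1 else 0 := rfl

/-- The coordinate at `τ` of a boundary is the coordinate of the filling chain at the partner `σ`,
which has not entered yet while `t` lies in the bar. -/
theorem d_barCoord (hN : N.IsAdapted w) (t : Set.Icc c d) (τ : K.Cell) (j : ℕ) :
    (K.chainComplex w t).d j i ≫ N.barCoord w i t τ = 0 := by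
  classical
  by_cases hij : j = i + 1
  · subst hij
    ext (x : K.chains w t (i + 1))
    refine (barCoord_apply t τ _).trans ?_
    refine (congrArg (fun u => if t ∈ (N.bar w c d i τ).1 then N.coord τ u else 0)
      (chainComplex_d_apply w t i x)).trans ?_
    change (if _ then _ else _) = (0 : k)
    split_ifs with ht
    · cases h : N.p τ with
      | none => exact N.coord_boundary_of_none h _
      | some σ =>
        rw [N.coord_boundary_of_some h]
        exact coord_eq_zero_of_lt hN (ht.2.2.2 σ h) x.2
    · rfl
  · rw [(K.chainComplex w t).shape j i fun h => hij h.symm, zero_comp]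

/-- The coordinate of a homology class along a bar. -/
noncomputable def homologyCoord (hN : N.IsAdapted w) (t : Set.Icc c d) (τ : K.Cell) :
    (K.chainComplex w t).homology i ⟶ ModuleCat.of k (intervalFiber k (N.bar w c d i τ) t) :=
  (K.chainComplex w t).homologyι i ≫
    (K.chainComplex w t).descOpcycles (N.barCoord w i t τ) _ rfl (d_barCoord hN t τ _)

/-- The homology class of the generator of a bar. -/
noncomputable def homologyClass (hN : N.IsAdapted w) (t : Set.Icc c d) (τ : K.Cell) :
    ModuleCat.of k (intervalFiber k (N.bar w c d i τ) t) ⟶ (K.chainComplex w t).homology i :=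
  (K.chainComplex w t).liftCycles (barCycle hN t τ) _ rfl (barCycle_d hN t τ _) ≫
    (K.chainComplex w t).homologyπ i

theorem homologyπ_homologyCoord (hN : N.IsAdapted w) (t : Set.Icc c d) (τ : K.Cell) :
    (K.chainComplex w t).homologyπ i ≫ homologyCoord hN t τ =
      (K.chainComplex w t).iCycles i ≫ N.barCoord w i t τ := by
  simp [homologyCoord]

theorem homologyClass_homologyι (hN : N.IsAdapted w) (t : Set.Icc c d) (τ : K.Cell) :
    homologyClass hN t τ ≫ (K.chainComplex w t).homologyι i =
      barCycle hN t τ ≫ (K.chainComplex w t).pOpcycles i := by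
  simp [homologyClass]

theorem homologyClass_homologyCoord (hN : N.IsAdapted w) (t : Set.Icc c d) (σ τ : K.Cell) :
    homologyClass (i := i) hN t σ ≫ homologyCoord hN t τ =
      barCycle hN t σ ≫ N.barCoord w i t τ := by
  simp [homologyClass, homologyCoord]

theorem homologyClass_homologyCoord_self (hN : N.IsAdapted w) (t : Set.Icc c d) (τ : K.Cell) :
    homologyClass (i := i) hN t τ ≫ homologyCoord hN t τ = 𝟙 _ := by
  classical
  rw [homologyClass_homologyCoord]
  ext x
  refine (barCoord_apply t τ _).trans ?_
  change (if _ then N.coord τ (x.1 • N.F τ) else 0) = x.1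
  split_ifs with h
  · rw [map_smul, N.coord_self, smul_eq_mul, mul_one]
  · exact (x.2 h).symm

theorem homologyClass_homologyCoord_ne (hN : N.IsAdapted w) (t : Set.Icc c d) {σ τ : K.Cell}
    (h : τ ≠ σ) : homologyClass (i := i) hN t σ ≫ homologyCoord hN t τ = 0 := by
  classical
  rw [homologyClass_homologyCoord]
  ext x
  refine (barCoord_apply t τ _).trans ?_
  change (if _ then N.coord τ (x.1 • N.F σ) else 0) = (0 : k)
  split_ifs
  · rw [map_smul, N.coord_ne σ τ h, smul_zero]
  · rfl

theorem iCycles_boundary (t : ℝ) (z : (K.chainComplex w t).cycles i) :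
    K.boundary (((K.chainComplex w t).iCycles i).hom z : K.chains w t i).1 = 0 := by
  cases i with
  | zero => exact boundary_eq_zero_of_dim_zero w t (Subtype.property _)
  | succ j =>
    refine (chainComplex_d_apply w t j _).symm.trans ?_
    have h := (K.chainComplex w t).iCycles_d (j + 1) j
    have h2 := congrArg (fun f => f.hom z) h
    exact congrArg Subtype.val h2

theorem pOpcycles_eq_of_sub_eq_boundary (t : ℝ) (x y : K.chains w t i)
    (z : K.chains w t (i + 1)) (h : x.1 - y.1 = K.boundary z.1) :
    ((K.chainComplex w t).pOpcycles i).hom x = ((K.chainComplex w t).pOpcycles i).hom y := by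
  have h1 : ((K.chainComplex w t).d (i + 1) i).hom z = x - y :=
    Subtype.ext ((chainComplex_d_apply w t i z).trans h.symm)
  have h2 := congrArg (fun f => f.hom z) ((K.chainComplex w t).d_pOpcycles (i + 1) i)
  have h3 : ((K.chainComplex w t).pOpcycles i).hom (x - y) = 0 := by
    rw [← h1]
    exact h2
  rw [← sub_eq_zero, ← h3]
  exact (map_sub ((K.chainComplex w t).pOpcycles i).hom x y).symm

/-- Expand a cycle in the basis. The components at deaths vanish, those whose partner has entered
are boundaries, and the remaining ones are the bars alive at `t`. Composing with `homologyπ` and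
`homologyι` reduces the claim to chains modulo boundaries. -/
theorem sum_homologyCoord_homologyClass (hN : N.IsAdapted w) (t : Set.Icc c d) :
    ∑ τ, homologyCoord (i := i) hN t τ ≫ homologyClass hN t τ = 𝟙 _ := by
  classical
  rw [← cancel_epi ((K.chainComplex w t).homologyπ i),
    ← cancel_mono ((K.chainComplex w t).homologyι i)]
  simp only [Preadditive.comp_sum, Preadditive.sum_comp, Category.assoc, homologyClass_homologyι]
  simp only [← Category.assoc, homologyπ_homologyCoord, Category.comp_id]
  rw [HomologicalComplex.homology_π_ι, ← Preadditive.sum_comp]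
  ext z
  have hz := iCycles_boundary (w := w) (i := i) (t : ℝ) z
  set x : K.chains w t i := ((K.chainComplex w t).iCycles i).hom z with hx
  have hsum : (∑ τ, ((K.chainComplex w t).iCycles i ≫ N.barCoord w i t τ) ≫ barCycle hN t τ).hom z
      = ∑ τ, (barCycle hN t τ).hom ((N.barCoord w i t τ).hom x) := by
    rw [ModuleCat.hom_sum, LinearMap.sum_apply]
    rfl
  rw [ModuleCat.hom_comp, ModuleCat.hom_comp, LinearMap.comp_apply, LinearMap.comp_apply, hsum]
  -- The filling chain puts the coordinate at `τ` on `F σ` for each pair `(τ, σ)` whose death `σ`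
  -- has entered.
  refine (pOpcycles_eq_of_sub_eq_boundary (w := w) (i := i) (t : ℝ) x _
    ⟨∑ τ, ∑ σ, if N.p τ = some σ ∧ w σ ≤ t then N.coord τ x.1 • N.F σ else 0, ?_⟩ ?_).symm
  · refine Submodule.sum_mem _ fun τ _ => Submodule.sum_mem _ fun σ _ => ?_
    split_ifs with h
    · intro ρ hρ
      have h1 : N.coord τ x.1 ≠ 0 := left_ne_zero_of_mul hρ
      have h2 : N.F σ ρ ≠ 0 := right_ne_zero_of_mul hρ
      refine ⟨(hN.le_of_F σ ρ h2).trans h.2, ?_⟩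
      rw [N.dim_of_F σ ρ h2, N.dim_of_some h.1]
      by_contra h3
      exact h1 (coord_eq_zero_of_dim_ne (w := w) (t := t) (i := i) (fun h4 => h3 (by rw [h4])) x.2)
    · exact Submodule.zero_mem _
  · have hval : (∑ τ, (barCycle (i := i) hN t τ).hom ((N.barCoord w i t τ).hom x) :
        K.chains w t i).1 = ∑ τ, (if t ∈ (N.bar w c d i τ).1 then N.coord τ x.1 else 0) • N.F τ := by
      exact map_sum (K.chains w t i).subtype
        (fun τ => ((barCycle (i := i) hN t τ).hom ((N.barCoord w i t τ).hom x) :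
          K.chains w t i)) Finset.univ
    refine (congrArg (fun u => x.1 - u) hval).trans ?_
    refine (congrArg (fun u => u - _) (N.sum_coord x.1).symm).trans ?_
    rw [← Finset.sum_sub_distrib, map_sum]
    refine Finset.sum_congr rfl fun τ _ => ?_
    rw [map_sum, ← sub_smul]
    by_cases hx0 : N.coord τ x.1 = 0
    · rw [hx0]
      simp
    · have hdim : K.dim τ = i := by
        by_contra h
        exact hx0 (coord_eq_zero_of_dim_ne (w := w) h x.2)
      have hle : w τ ≤ t := by
        by_contra h
        exact hx0 (coord_eq_zero_of_lt hN (not_le.1 h) x.2)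
      have hbirth : N.p.symm τ = none := by
        cases h : N.p.symm τ with
        | none => rfl
        | some ρ => exact absurd (N.coord_of_cycle (N.p_of_symm h) hz) hx0
      cases hp : N.p τ with
      | none =>
        have hbar : t ∈ (N.bar w c d i τ).1 := ⟨hdim, hbirth, hle, fun σ hσ => by
          rw [hp] at hσ
          cases hσ⟩
        simp [hbar]
      | some σ =>
        rw [Finset.sum_eq_single σ]
        · by_cases hσ : w σ ≤ t
          · have hbar : t ∉ (N.bar w c d i τ).1 := fun h =>
              absurd hσ (not_le.2 (h.2.2.2 σ hp))
            rw [if_neg hbar, sub_zero, if_pos ⟨rfl, hσ⟩, map_smul, N.boundary_of_some σ τ hp]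
          · have hbar : t ∈ (N.bar w c d i τ).1 := ⟨hdim, hbirth, hle, fun σ' hσ' => by
              rw [hp] at hσ'
              rw [← Option.some.inj hσ']
              exact not_le.1 hσ⟩
            rw [if_pos hbar, sub_self, zero_smul, if_neg fun h => hσ h.2, map_zero]
        · intro σ' _ hσ'
          rw [if_neg, map_zero]
          rintro ⟨h, -⟩
          exact hσ' (Option.some.inj h).symm
        · intro h
          exact absurd (Finset.mem_univ σ) h

/-- The critical case is that of `t` in the bar and `s` not: then `τ` is still unborn at `s`, so the
coordinate already vanishes there. -/
theorem homologyCoord_naturality (hN : N.IsAdapted w) (τ : K.Cell) {s t : Set.Icc c d}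
    (f : s ⟶ t) (φ : K.chainComplex w s ⟶ K.chainComplex w t)
    (hφ : φ = (K.filteredComplex w c d).map f)
    (g : ModuleCat.of k (intervalFiber k (N.bar w c d i τ) s) ⟶
      ModuleCat.of k (intervalFiber k (N.bar w c d i τ) t))
    (hg : g = (intervalModule k (N.bar w c d i τ)).map f) :
    HomologicalComplex.homologyMap φ i ≫ homologyCoord hN t τ = homologyCoord hN s τ ≫ g := by
  classical
  rw [← cancel_epi ((K.chainComplex w s).homologyπ i),
    HomologicalComplex.homologyπ_naturality_assoc, homologyπ_homologyCoord,
    ← Category.assoc ((K.chainComplex w s).homologyπ i),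
    homologyπ_homologyCoord, HomologicalComplex.cyclesMap_i_assoc, Category.assoc]
  congr 1
  ext (x : K.chains w s i)
  have hst : (s : ℝ) ≤ t := leOfHom f
  subst hφ hg
  change (if t ∈ (N.bar w c d i τ).1 then N.coord τ x.1 else 0) =
    ((if t ∈ (N.bar w c d i τ).1 then LinearMap.id else 0 : k →ₗ[k] k)
      (if s ∈ (N.bar w c d i τ).1 then N.coord τ x.1 else 0))
  by_cases ht : t ∈ (N.bar w c d i τ).1
  · rw [if_pos ht, if_pos ht, LinearMap.id_apply]
    by_cases hs : s ∈ (N.bar w c d i τ).1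
    · rw [if_pos hs]
    · rw [if_neg hs]
      refine coord_eq_zero_of_lt hN ?_ x.2
      by_contra hlt
      exact hs ⟨ht.1, ht.2.1, not_lt.1 hlt, fun σ hσ => hst.trans_lt (ht.2.2.2 σ hσ)⟩
  · rw [if_neg ht, if_neg ht, LinearMap.zero_apply]

/-- The coordinate along a bar, as a morphism of persistence modules. -/
noncomputable def homologyCoordHom (hN : N.IsAdapted w) (τ : K.Cell) :
    K.persistentHomology w c d i ⟶ intervalModule k (N.bar w c d i τ) where
  app t := homologyCoord hN t τ
  naturality _ _ f := homologyCoord_naturality hN τ f _ rfl _ rfl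

/-- The nonempty bars of a normal form are a barcode of the persistent homology. -/
theorem isBarcode (hN : N.IsAdapted w) {m : ℕ} (g : Fin m → K.Cell) (hg : Function.Injective g)
    (hrange : ∀ τ, τ ∈ Set.range g ↔ (N.bar w c d i τ).1.Nonempty) :
    IsBarcode (K.persistentHomology w c d i) (fun j => N.bar w c d i (g j)) := by
  refine ⟨fun j => (hrange _).1 ⟨j, rfl⟩, ?_⟩
  refine nonempty_iso_biproduct _ _ (fun j => homologyCoordHom hN (g j))
    (fun j t => homologyClass hN t (g j)) (fun t => ?_)
    (fun t j => homologyClass_homologyCoord_self hN t (g j))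
    (fun t j l hjl => homologyClass_homologyCoord_ne hN t fun h => hjl (hg h).symm)
  refine Eq.trans ?_ (sum_homologyCoord_homologyClass (i := i) hN t)
  refine Finset.sum_of_injOn g hg.injOn (fun _ _ => Finset.mem_coe.2 (Finset.mem_univ _))
    (fun τ _ hτ => ?_) (fun _ _ => rfl)
  have hempty : ¬ (N.bar w c d i τ).1.Nonempty := fun h => by
    obtain ⟨j, hj⟩ := (hrange τ).2 h
    exact hτ ⟨j, Finset.mem_coe.2 (Finset.mem_univ j), hj⟩
  have hzero : homologyCoord (i := i) hN t τ = 0 := by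
    ext x
    exact (homologyCoord (i := i) hN t τ x).2 fun h => hempty ⟨t, h⟩
  rw [hzero, zero_comp]
  rfl

end NormalForm

end CellComplex

/-! ### Rank functions of interval decompositions and the metric `dRk`. -/

section Rank

variable {k : Type u} [Field k] {c d : ℝ}

theorem intervalModule_map_apply {I : IndexInterval c d} {s t : Set.Icc c d} (f : s ⟶ t)
    (x : intervalFiber k I s) :
    (((intervalModule k I).map f).hom x : intervalFiber k I t).1 =
      (open Classical in if t ∈ I.1 then x.1 else 0) := by
  classical
  change ((if t ∈ I.1 then LinearMap.id else 0 : k →ₗ[k] k) x.1) = _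
  split_ifs <;> rfl

theorem finrank_of_forall_eq_zero {m : ℕ} (J : Set (Fin m)) (T : Submodule k (Fin m → k))
    (hT : ∀ f, f ∈ T ↔ ∀ j ∈ J, f j = 0) :
    Module.finrank k T = ∑ j, (open Classical in if j ∈ J then 0 else 1) := by
  classical
  have h : T = ⨅ j ∈ J, LinearMap.ker (LinearMap.proj j : (Fin m → k) →ₗ[k] k) := by
    ext f
    rw [hT]
    simp
  rw [h, (LinearMap.iInfKerProjEquiv k (fun _ : Fin m => k) (I := Jᶜ) (J := J)
    disjoint_compl_left (by rw [Set.compl_union_self])).finrank_eq, Module.finrank_fintype_fun_eq_card,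
    Fintype.card_subtype, Finset.card_filter]
  refine Finset.sum_congr rfl fun j _ => ?_
  by_cases hj : j ∈ J <;> simp [hj]

/-- The rank of a structure map of a direct sum of interval modules counts the intervals that
contain both ends. -/
theorem finrank_range_map_of_iso {m : ℕ} {α : Fin m → IndexInterval c d}
    {M : PersistenceModule k c d} (e : M ≅ ⨁ fun j => intervalModule k (α j)) {r s : Set.Icc c d}
    (f : r ⟶ s) :
    Module.finrank k (LinearMap.range (M.map f).hom) =
      ∑ j, (open Classical in if r ∈ (α j).1 ∧ s ∈ (α j).1 then 1 else 0) := by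
  classical
  let A : Fin m → PersistenceModule k c d := fun j => intervalModule k (α j)
  let P : ∀ j, M ⟶ A j := fun j => e.hom ≫ biproduct.π A j
  let Q : ∀ j, A j ⟶ M := fun j => biproduct.ι A j ≫ e.inv
  have hPQ : ∑ j, P j ≫ Q j = 𝟙 M := by
    have h : ∀ j, P j ≫ Q j = e.hom ≫ (biproduct.π A j ≫ biproduct.ι A j) ≫ e.inv := fun j => by
      simp only [P, Q, Category.assoc]
    simp only [h]
    rw [← Preadditive.comp_sum, ← Preadditive.sum_comp, biproduct.total, Category.id_comp,
      e.hom_inv_id]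
  have hQP : ∀ j, Q j ≫ P j = 𝟙 (A j) := fun j => by
    simp [P, Q]
  have hQP' : ∀ j l, j ≠ l → Q j ≫ P l = 0 := fun j l h => by
    simp [P, Q, biproduct.ι_π_ne A h]
  -- The projections embed each `M.obj t` into `k ^ m`; the image of the structure map becomes the
  -- space of vectors supported on the intervals that contain both ends.
  let θ : ∀ t, M.obj t →ₗ[k] (Fin m → k) := fun t =>
    LinearMap.pi fun j => (intervalFiber k (α j) t).subtype ∘ₗ ((P j).app t).hom
  have hθ : ∀ t x j, θ t x j = (((P j).app t).hom x : intervalFiber k (α j) t).1 :=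
    fun _ _ _ => rfl
  have hinj : ∀ t, Function.Injective (θ t) := by
    intro t
    rw [injective_iff_map_eq_zero]
    intro x hx
    have h1 : ∀ j, ((P j).app t).hom x = (0 : intervalFiber k (α j) t) := fun j =>
      Subtype.ext (congrFun hx j)
    have h2 := congrArg (fun g : M ⟶ M => (g.app t).hom x) hPQ
    simp only [NatTrans.app_sum, ModuleCat.hom_sum, LinearMap.sum_apply] at h2
    refine h2.symm.trans (Finset.sum_eq_zero fun j _ => ?_)
    change ((Q j).app t).hom (((P j).app t).hom x) = 0
    refine (congrArg _ (h1 j)).trans ?_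
    exact map_zero ((Q j).app t).hom
  have hnat : ∀ x j, θ s ((M.map f).hom x) j = if s ∈ (α j).1 then θ r x j else 0 := by
    intro x j
    have h := congrArg (fun g : M.obj r ⟶ (A j).obj s => g.hom x) ((P j).naturality f)
    exact (congrArg Subtype.val h).trans (intervalModule_map_apply f _)
  have hsurj : ∀ g : Fin m → k, (∀ j, r ∉ (α j).1 → g j = 0) → ∃ x, θ r x = g := by
    intro g hg
    let y : ∀ j, intervalFiber k (α j) r := fun j => ⟨g j, hg j⟩
    refine ⟨∑ j, ((Q j).app r).hom (y j), ?_⟩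
    ext l
    rw [map_sum, Finset.sum_apply, Finset.sum_eq_single l]
    · rw [hθ]
      have h := congrArg (fun φ : A l ⟶ A l => (φ.app r).hom (y l)) (hQP l)
      exact congrArg Subtype.val h
    · intro j _ hj
      rw [hθ]
      have h := congrArg (fun φ : A j ⟶ A l => (φ.app r).hom (y j)) (hQP' j l hj)
      exact congrArg Subtype.val h
    · intro h
      exact absurd (Finset.mem_univ l) h
  rw [(Submodule.equivMapOfInjective (θ s) (hinj s) _).finrank_eq]
  rw [finrank_of_forall_eq_zero {j | ¬ (r ∈ (α j).1 ∧ s ∈ (α j).1)}]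
  · refine Finset.sum_congr rfl fun j _ => ?_
    by_cases h : r ∈ (α j).1 ∧ s ∈ (α j).1 <;> simp [h]
  · intro g
    simp only [Submodule.mem_map, LinearMap.mem_range, exists_exists_eq_and, Set.mem_ofPred_eq]
    constructor
    · rintro ⟨x, rfl⟩ j hj
      rw [hnat]
      split_ifs with hs
      · exact (((P j).app r).hom x : intervalFiber k (α j) r).2 fun hr => hj ⟨hr, hs⟩
      · rfl
    · intro hg
      obtain ⟨x, hx⟩ := hsurj g fun j hj => hg j fun h => hj h.1
      refine ⟨x, ?_⟩
      ext j
      rw [hnat, hx]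
      split_ifs with hs
      · rfl
      · exact (hg j fun h => hs h.2).symm

/-- The region of the plane on which the rank function of an interval module is one. -/
def rankSupport (I : IndexInterval c d) : Set (ℝ × ℝ) :=
  {p | p.1 ≤ p.2 ∧ p.1 ∈ Subtype.val '' I.1 ∧ p.2 ∈ Subtype.val '' I.1}

theorem mem_rankSupport {I : IndexInterval c d} (r s : Set.Icc c d) :
    ((r : ℝ), (s : ℝ)) ∈ rankSupport I ↔ r ≤ s ∧ r ∈ I.1 ∧ s ∈ I.1 := by
  simp only [rankSupport, Set.mem_ofPred_eq, Subtype.val_injective.mem_set_image, Subtype.coe_le_coe]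

theorem rankFunction_eq_sum_of_iso {m : ℕ} {α : Fin m → IndexInterval c d}
    {M : PersistenceModule k c d} (h : Nonempty (M ≅ ⨁ fun j => intervalModule k (α j)))
    (p : ℝ × ℝ) :
    rankFunction M p = ∑ j, (rankSupport (α j)).indicator (fun _ => (1 : ℝ)) p := by
  classical
  obtain ⟨e⟩ := h
  rw [rankFunction]
  split_ifs with hp
  · rw [finrank_range_map_of_iso e, Nat.cast_sum]
    refine Finset.sum_congr rfl fun j _ => ?_
    have h1 := mem_rankSupport (I := α j) ⟨p.1, hp.1⟩ ⟨p.2, hp.2.1⟩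
    have h2 : (⟨p.1, hp.1⟩ : Set.Icc c d) ≤ ⟨p.2, hp.2.1⟩ := hp.2.2
    by_cases h3 : (⟨p.1, hp.1⟩ : Set.Icc c d) ∈ (α j).1 ∧ (⟨p.2, hp.2.1⟩ : Set.Icc c d) ∈ (α j).1
    · rw [if_pos h3, Set.indicator_of_mem (h1.2 ⟨h2, h3⟩), Nat.cast_one]
    · rw [if_neg h3, Set.indicator_of_notMem fun h => h3 (h1.1 h).2, Nat.cast_zero]
  · refine (Finset.sum_eq_zero fun j _ => Set.indicator_of_notMem (fun h => hp ?_) _).symm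
    obtain ⟨h1, ⟨r, -, hr⟩, ⟨s, -, hs⟩⟩ := h
    exact ⟨hr ▸ r.2, hs ▸ s.2, h1⟩

theorem rankFunction_intervalModule (I : IndexInterval c d) (p : ℝ × ℝ) :
    rankFunction (intervalModule k I) p = (rankSupport I).indicator (fun _ => (1 : ℝ)) p := by
  rw [rankFunction_eq_sum_of_iso (m := 1) (α := fun _ => I), Fin.sum_univ_one]
  refine nonempty_iso_biproduct _ _ (fun _ => 𝟙 _) (fun _ _ => 𝟙 _) (fun t => ?_) (fun t j => ?_)
    (fun t j l h => absurd (Subsingleton.elim j l) h)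
  · rw [Fin.sum_univ_one, NatTrans.id_app, Category.comp_id]
  · rw [NatTrans.id_app, Category.comp_id]

theorem measurableSet_rankSupport (I : IndexInterval c d) : MeasurableSet (rankSupport I) := by
  have h : (Subtype.val '' I.1 : Set ℝ).OrdConnected := by
    refine ⟨?_⟩
    rintro _ ⟨r, hr, rfl⟩ _ ⟨s, hs, rfl⟩ t ht
    exact ⟨⟨t, r.2.1.trans ht.1, ht.2.trans s.2.2⟩, I.2.out hr hs ⟨ht.1, ht.2⟩, rfl⟩
  exact (measurableSet_le measurable_fst measurable_snd).inter
    ((measurable_fst h.measurableSet).inter (measurable_snd h.measurableSet))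

/-- The difference of the rank functions of two interval modules. -/
noncomputable def rankDiff (I J : IndexInterval c d) (p : ℝ × ℝ) : ℝ≥0∞ :=
  ENNReal.ofReal |(rankSupport I).indicator (fun _ => (1 : ℝ)) p -
    (rankSupport J).indicator (fun _ => (1 : ℝ)) p|

theorem measurable_rankDiff (I J : IndexInterval c d) : Measurable (rankDiff I J) :=
  (((measurable_const.indicator (measurableSet_rankSupport I)).sub
    (measurable_const.indicator (measurableSet_rankSupport J))).abs).ennreal_ofReal

theorem dRk_eq_lintegral (I J : IndexInterval c d) : dRk k I J = ∫⁻ p, rankDiff I J p := by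
  simp only [dRk, rankFunction_intervalModule]
  rfl

theorem rankDiff_self (I : IndexInterval c d) (p : ℝ × ℝ) : rankDiff I I p = 0 := by
  simp [rankDiff]

theorem rankDiff_comm (I J : IndexInterval c d) : rankDiff I J = rankDiff J I := by
  ext p
  rw [rankDiff, rankDiff, abs_sub_comm]

theorem rankDiff_triangle (I J L : IndexInterval c d) (p : ℝ × ℝ) :
    rankDiff I L p ≤ rankDiff I J p + rankDiff J L p := by
  rw [rankDiff, rankDiff, rankDiff, ← ENNReal.ofReal_add (abs_nonneg _) (abs_nonneg _)]
  exact ENNReal.ofReal_le_ofReal (abs_sub_le _ _ _)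

theorem rankDiff_eq (I J : IndexInterval c d) (p : ℝ × ℝ) :
    rankDiff I J p =
      (open Classical in if (p ∈ rankSupport I ↔ p ∈ rankSupport J) then 0 else 1) := by
  classical
  by_cases hI : p ∈ rankSupport I <;> by_cases hJ : p ∈ rankSupport J <;> simp [rankDiff, hI, hJ]

theorem dRk_self (I : IndexInterval c d) : dRk k I I = 0 := by
  simp [dRk_eq_lintegral, rankDiff_self]

theorem dRk_comm (I J : IndexInterval c d) : dRk k I J = dRk k J I := by
  rw [dRk_eq_lintegral, dRk_eq_lintegral, rankDiff_comm]

theorem dRk_triangle (I J L : IndexInterval c d) : dRk k I L ≤ dRk k I J + dRk k J L := by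
  simp only [dRk_eq_lintegral]
  rw [← lintegral_add_left (measurable_rankDiff I J)]
  exact lintegral_mono fun p => rankDiff_triangle I J L p

theorem rankSupport_diagonalPoint : rankSupport (diagonalPoint c d) = ∅ := by
  ext p
  simp [rankSupport, diagonalPoint]

theorem rankDiff_diagonalPoint (I : IndexInterval c d) (p : ℝ × ℝ) :
    rankDiff I (diagonalPoint c d) p =
      ENNReal.ofReal |(rankSupport I).indicator (fun _ => (1 : ℝ)) p| := by
  simp [rankDiff, rankSupport_diagonalPoint]

end Rank

/-! ### Bounds for `wassersteinRk`, and uniqueness of barcodes. -/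

section Barcodes

variable {k : Type u} [Field k] {c d : ℝ}

/-- The triangle inequality after splitting the second sum into its matched and unmatched terms; it
is applied to rank functions at a single point of the plane. -/
theorem ofReal_abs_sum_sub_sum_le {m n : ℕ} (x : Fin m → ℝ) (y : Fin n → ℝ) (φ : Fin m ≃. Fin n) :
    ENNReal.ofReal |∑ i, x i - ∑ j, y j| ≤
      (∑ i, match φ i with
        | some j => ENNReal.ofReal |x i - y j|
        | none => ENNReal.ofReal |x i|) +
      ∑ j, match φ.symm j with
        | some _ => 0
        | none => ENNReal.ofReal |y j| := by
  have hy : ∑ j, y j = (∑ i, match φ i with | some j => y j | none => 0) +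
      ∑ j, match φ.symm j with | some _ => 0 | none => y j := by
    have h1 : ∀ i, (match φ i with | some j => y j | none => 0) =
        ∑ j, if φ i = some j then y j else 0 := by
      intro i
      cases φ i <;> simp
    have h2 : ∀ j, ∑ i, (if φ i = some j then y j else 0) =
        match φ.symm j with | some _ => y j | none => 0 := by
      intro j
      have h3 : ∀ i, φ i = some j ↔ φ.symm j = some i := fun i => (φ.eq_some_iff).symm
      simp only [h3]
      cases φ.symm j <;> simp
    simp only [h1]
    rw [Finset.sum_comm, ← Finset.sum_add_distrib]
    refine Finset.sum_congr rfl fun j _ => ?_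
    rw [h2]
    cases φ.symm j <;> simp
  have hsplit : ∑ i, x i - ∑ j, y j =
      ∑ i, (x i - match φ i with | some j => y j | none => 0) -
        ∑ j, match φ.symm j with | some _ => 0 | none => y j := by
    rw [hy, Finset.sum_sub_distrib]
    ring
  rw [hsplit]
  refine (ENNReal.ofReal_le_ofReal ((abs_sub _ _).trans (add_le_add
    (Finset.abs_sum_le_sum_abs _ _) (Finset.abs_sum_le_sum_abs _ _)))).trans ?_
  rw [ENNReal.ofReal_add (Finset.sum_nonneg fun _ _ => abs_nonneg _)
    (Finset.sum_nonneg fun _ _ => abs_nonneg _),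
    ENNReal.ofReal_sum_of_nonneg fun _ _ => abs_nonneg _,
    ENNReal.ofReal_sum_of_nonneg fun _ _ => abs_nonneg _]
  refine add_le_add (Finset.sum_le_sum fun i _ => ?_) (Finset.sum_le_sum fun j _ => ?_)
  · cases φ i <;> simp
  · cases φ.symm j <;> simp

/-- The cost of a matching is the integral of a pointwise sum, and ranks add over a barcode, so the
triangle inequality can be used under the integral. -/
theorem lintegral_abs_rankFunction_sub_le_matchingCost {M N : PersistenceModule k c d} {m n : ℕ}
    {α : Fin m → IndexInterval c d} {β : Fin n → IndexInterval c d} (hα : IsBarcode M α)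
    (hβ : IsBarcode N β) (φ : Fin m ≃. Fin n) :
    ∫⁻ p, ENNReal.ofReal |rankFunction M p - rankFunction N p| ≤ matchingCost k α β φ := by
  have h1 : matchingCost k α β φ = ∫⁻ p,
      ((∑ i, match φ i with
        | some j => rankDiff (α i) (β j) p
        | none => rankDiff (α i) (diagonalPoint c d) p) +
      ∑ j, match φ.symm j with
        | some _ => 0
        | none => rankDiff (diagonalPoint c d) (β j) p) := by
    have hm1 : ∀ i, Measurable fun p => (match φ i with
        | some j => rankDiff (α i) (β j) p
        | none => rankDiff (α i) (diagonalPoint c d) p) := fun i => by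
      cases φ i <;> exact measurable_rankDiff _ _
    have hm2 : ∀ j, Measurable fun p => (match φ.symm j with
        | some _ => 0
        | none => rankDiff (diagonalPoint c d) (β j) p) := fun j => by
      cases φ.symm j
      · exact measurable_rankDiff _ _
      · exact measurable_const
    rw [lintegral_add_left (Finset.measurable_fun_sum _ fun i _ => hm1 i),
      lintegral_finsetSum _ fun i _ => hm1 i, lintegral_finsetSum _ fun j _ => hm2 j,
      matchingCost]
    congr 1
    · refine Finset.sum_congr rfl fun i _ => ?_
      cases φ i <;> exact dRk_eq_lintegral _ _
    · refine Finset.sum_congr rfl fun j _ => ?_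
      cases φ.symm j
      · exact dRk_eq_lintegral _ _
      · simp
  rw [h1]
  refine lintegral_mono fun p => ?_
  rw [rankFunction_eq_sum_of_iso hα.2, rankFunction_eq_sum_of_iso hβ.2]
  refine (ofReal_abs_sum_sub_sum_le _ _ φ).trans (le_of_eq ?_)
  congr 1
  · refine Finset.sum_congr rfl fun i _ => ?_
    cases φ i
    · exact (rankDiff_diagonalPoint _ _).symm
    · rfl
  · refine Finset.sum_congr rfl fun j _ => ?_
    cases φ.symm j
    · rw [rankDiff_comm]
      exact (rankDiff_diagonalPoint _ _).symm
    · rfl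

/-- `W_1^rk` is bounded below by the `L¹` distance of the rank functions. -/
theorem lintegral_abs_rankFunction_sub_le_wassersteinRk (M N : PersistenceModule k c d) :
    ∫⁻ p, ENNReal.ofReal |rankFunction M p - rankFunction N p| ≤ wassersteinRk M N :=
  le_iInf fun _ => le_iInf fun _ => le_iInf fun _ => le_iInf fun _ => le_iInf fun hα =>
    le_iInf fun hβ => le_iInf fun φ => lintegral_abs_rankFunction_sub_le_matchingCost hα hβ φ

theorem wassersteinRk_le_matchingCost {M N : PersistenceModule k c d} {m n : ℕ}
    {α : Fin m → IndexInterval c d} {β : Fin n → IndexInterval c d} (hα : IsBarcode M α)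
    (hβ : IsBarcode N β) (φ : Fin m ≃. Fin n) : wassersteinRk M N ≤ matchingCost k α β φ := by
  rw [wassersteinRk]
  refine iInf_le_of_le m ?_
  refine iInf_le_of_le n ?_
  refine iInf_le_of_le α ?_
  refine iInf_le_of_le β ?_
  refine iInf_le_of_le hα ?_
  refine iInf_le_of_le hβ ?_
  exact iInf_le _ φ

/-- The nonempty members of the family `α` form a barcode of `M`. -/
def IsPaddedBarcode {J : Type*} (M : PersistenceModule k c d) (α : J → IndexInterval c d) : Prop :=
  ∀ (m : ℕ) (g : Fin m → J), Function.Injective g →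
    (∀ j, j ∈ Set.range g ↔ (α j).1.Nonempty) → IsBarcode M fun l => α (g l)

theorem IsPaddedBarcode.comp_equiv {J : Type*} {M : PersistenceModule k c d}
    {α : J → IndexInterval c d} (h : IsPaddedBarcode M α) (e : J ≃ J) :
    IsPaddedBarcode M (α ∘ e) := by
  intro m g hg hr
  refine h m (e ∘ g) (e.injective.comp hg) fun j => ?_
  rw [Set.range_comp, ← e.apply_symm_apply j, e.injective.mem_set_image, hr]
  simp

theorem exists_enumeration {J : Type*} [Finite J] (P : J → Prop) :
    ∃ (m : ℕ) (g : Fin m → J), Function.Injective g ∧ ∀ j, j ∈ Set.range g ↔ P j := by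
  obtain ⟨m, ⟨e⟩⟩ := Finite.exists_equiv_fin {j // P j}
  refine ⟨m, Subtype.val ∘ e.symm, Subtype.val_injective.comp e.symm.injective, fun j => ?_⟩
  constructor
  · rintro ⟨l, rfl⟩
    exact (e.symm l).2
  · intro hj
    exact ⟨e ⟨j, hj⟩, by simp⟩

theorem eq_diagonalPoint {I : IndexInterval c d} (h : ¬ I.1.Nonempty) : I = diagonalPoint c d :=
  Subtype.ext (Set.not_nonempty_iff_eq_empty.1 h)

/-- `W_1^rk` is at most the cost of the matching along the index set. -/
theorem wassersteinRk_le_sum {J : Type*} [Fintype J] {M N : PersistenceModule k c d}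
    {α β : J → IndexInterval c d} (hα : IsPaddedBarcode M α) (hβ : IsPaddedBarcode N β) :
    wassersteinRk M N ≤ ∑ j, dRk k (α j) (β j) := by
  classical
  obtain ⟨m, f, hf, hfr⟩ := exists_enumeration fun j => (α j).1.Nonempty
  obtain ⟨n, g, hg, hgr⟩ := exists_enumeration fun j => (β j).1.Nonempty
  -- Two bars are matched when they carry the same index of `J`; a bar stays unmatched when the
  -- other family is empty at its index.
  let φ : Fin m ≃. Fin n :=
    { toFun := fun i => if h : ∃ j, g j = f i then some h.choose else none
      invFun := fun j => if h : ∃ i, f i = g j then some h.choose else none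
      inv := by
        intro i j
        have h1 : (if h : ∃ j, g j = f i then some h.choose else none) = some j ↔ g j = f i := by
          split_ifs with h
          · rw [Option.some.injEq]
            exact ⟨fun e => e ▸ h.choose_spec, fun e => hg (h.choose_spec.trans e.symm)⟩
          · simp only [false_iff]
            exact fun e => h ⟨j, e⟩
        have h2 : (if h : ∃ i, f i = g j then some h.choose else none) = some i ↔ f i = g j := by
          split_ifs with h
          · rw [Option.some.injEq]
            exact ⟨fun e => e ▸ h.choose_spec, fun e => hf (h.choose_spec.trans e.symm)⟩
          · simp only [false_iff]
            exact fun e => h ⟨i, e⟩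
        exact h2.trans (eq_comm.trans h1.symm) }
  have hφ : ∀ i j, φ i = some j → g j = f i := by
    intro i j h
    change (if h : ∃ j, g j = f i then some h.choose else none) = some j at h
    split_ifs at h with h'
    rw [← Option.some.inj h]
    exact h'.choose_spec
  have hφn : ∀ i, φ i = none → β (f i) = diagonalPoint c d := by
    intro i h
    change (if h : ∃ j, g j = f i then some h.choose else none) = none at h
    split_ifs at h with h'
    exact eq_diagonalPoint fun hne => h' ((hgr _).2 hne)
  have hφs : ∀ j, φ.symm j = none → α (g j) = diagonalPoint c d := by
    intro j h
    change (if h : ∃ i, f i = g j then some h.choose else none) = none at h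
    split_ifs at h with h'
    exact eq_diagonalPoint fun hne => h' ((hfr _).2 hne)
  refine (wassersteinRk_le_matchingCost (hα m f hf hfr) (hβ n g hg hgr) φ).trans ?_
  rw [matchingCost]
  have hsum1 : ∑ i, (match φ i with
      | some j => dRk k (α (f i)) (β (g j))
      | none => dRk k (α (f i)) (diagonalPoint c d)) =
      ∑ j ∈ Finset.univ.filter (fun j => j ∈ Set.range f), dRk k (α j) (β j) := by
    have hS : Finset.univ.filter (fun j => j ∈ Set.range f) = Finset.univ.map ⟨f, hf⟩ := by
      ext j
      simp
    rw [hS, Finset.sum_map]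
    refine Finset.sum_congr rfl fun i _ => ?_
    cases h : φ i with
    | none => exact congrArg (dRk k (α (f i))) (hφn i h).symm
    | some j => exact congrArg (fun x => dRk k (α (f i)) (β x)) (hφ i j h)
  have hsum2 : ∑ j, (match φ.symm j with
      | some _ => 0
      | none => dRk k (diagonalPoint c d) (β (g j))) ≤
      ∑ j ∈ Finset.univ.filter (fun j => ¬ j ∈ Set.range f), dRk k (α j) (β j) := by
    have h1 : ∀ j, (match φ.symm j with
        | some _ => 0
        | none => dRk k (diagonalPoint c d) (β (g j))) =
        if g j ∈ Set.range f then 0 else dRk k (α (g j)) (β (g j)) := by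
      intro j
      cases h : φ.symm j with
      | none =>
        rw [if_neg]
        · exact congrArg (fun x => dRk k x (β (g j))) (hφs j h).symm
        · intro h'
          exact absurd ((hfr _).1 h') (by
            rw [hφs j h]
            exact Set.not_nonempty_empty)
      | some i => exact (if_pos ⟨i, (hφ i j (φ.eq_some_iff.1 h)).symm⟩).symm
    simp only [h1]
    rw [Finset.sum_filter]
    have h2 : ∑ j, (if g j ∈ Set.range f then 0 else dRk k (α (g j)) (β (g j))) =
        ∑ x ∈ Finset.univ.map ⟨g, hg⟩, if x ∈ Set.range f then 0 else dRk k (α x) (β x) := by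
      rw [Finset.sum_map]
      rfl
    rw [h2]
    refine (Finset.sum_le_sum_of_subset (Finset.subset_univ _)).trans (le_of_eq ?_)
    refine Finset.sum_congr rfl fun x _ => ?_
    by_cases hx : x ∈ Set.range f
    · rw [if_pos hx, if_neg (not_not.2 hx)]
    · rw [if_neg hx, if_pos hx]
  refine (add_le_add hsum1.le hsum2).trans (le_of_eq ?_)
  exact Finset.sum_filter_add_sum_filter_not _ _ _

theorem IsPaddedBarcode.rankFunction_eq {J : Type*} [Fintype J] {M : PersistenceModule k c d}
    {α : J → IndexInterval c d} (h : IsPaddedBarcode M α) (p : ℝ × ℝ) :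
    rankFunction M p = ∑ j, (rankSupport (α j)).indicator (fun _ => (1 : ℝ)) p := by
  classical
  obtain ⟨m, f, hf, hfr⟩ := exists_enumeration fun j => (α j).1.Nonempty
  rw [rankFunction_eq_sum_of_iso (h m f hf hfr).2]
  refine Finset.sum_of_injOn f hf.injOn (fun _ _ => Finset.mem_coe.2 (Finset.mem_univ _))
    (fun j _ hj => ?_) (fun _ _ => rfl)
  have hempty : ¬ (α j).1.Nonempty := fun h => by
    obtain ⟨i, hi⟩ := (hfr j).2 h
    exact hj ⟨i, Finset.mem_coe.2 (Finset.mem_univ i), hi⟩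
  rw [eq_diagonalPoint hempty, rankSupport_diagonalPoint, Set.indicator_empty]

/-- The rank functions of distinct nonempty intervals are linearly independent. -/
theorem eq_zero_of_sum_indicator_eq_zero (S : Finset (IndexInterval c d))
    (hS : ∀ I ∈ S, I.1.Nonempty) (a : IndexInterval c d → ℝ)
    (h : ∀ p, ∑ I ∈ S, a I * (rankSupport I).indicator (fun _ => (1 : ℝ)) p = 0) :
    ∀ I ∈ S, a I = 0 := by
  classical
  by_contra hcon
  push Not at hcon
  have hne : (S.filter fun I => a I ≠ 0).Nonempty := by
    obtain ⟨I, hI, ha⟩ := hcon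
    exact ⟨I, Finset.mem_filter.2 ⟨hI, ha⟩⟩
  -- Choose `I` maximal for inclusion among the intervals with nonzero coefficient; every other such
  -- interval then misses a point `x J` of `I`. The value `x₀` is only a default.
  obtain ⟨I, hI⟩ := (S.filter fun I => a I ≠ 0).exists_maximal hne
  obtain ⟨hIS, haI⟩ := Finset.mem_filter.1 hI.1
  obtain ⟨x₀, hx₀⟩ := hS I hIS
  let x : IndexInterval c d → Set.Icc c d := fun J =>
    if h : ∃ x, x ∈ I.1 ∧ x ∉ J.1 then h.choose else x₀
  have hxI : ∀ J, x J ∈ I.1 := by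
    intro J
    simp only [x]
    split_ifs with h
    · exact h.choose_spec.1
    · exact hx₀
  have hxJ : ∀ J ∈ S, a J ≠ 0 → J ≠ I → x J ∉ J.1 := by
    intro J hJ haJ hJI
    have h : ∃ x, x ∈ I.1 ∧ x ∉ J.1 := by
      by_contra h'
      push Not at h'
      have hle : I ≤ J := h'
      exact hJI (le_antisymm (hI.2 (Finset.mem_filter.2 ⟨hJ, haJ⟩) hle) hle)
    simp only [x, dif_pos h]
    exact h.choose_spec.2
  have himg : (S.image x).Nonempty := ⟨x I, Finset.mem_image_of_mem x hIS⟩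
  -- An interval that contains the least and the greatest chosen point contains all of them by
  -- convexity, so at `(r, s)` only `I` contributes.
  set r := (S.image x).min' himg with hr
  set s := (S.image x).max' himg with hs
  have hrI : r ∈ I.1 := by
    obtain ⟨J, -, hJ⟩ := Finset.mem_image.1 (Finset.min'_mem _ himg)
    rw [hr, ← hJ]
    exact hxI J
  have hsI : s ∈ I.1 := by
    obtain ⟨J, -, hJ⟩ := Finset.mem_image.1 (Finset.max'_mem _ himg)
    rw [hs, ← hJ]
    exact hxI J
  have hrx : ∀ J ∈ S, r ≤ x J := fun J hJ => Finset.min'_le _ _ (Finset.mem_image_of_mem x hJ)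
  have hxs : ∀ J ∈ S, x J ≤ s := fun J hJ => Finset.le_max' _ _ (Finset.mem_image_of_mem x hJ)
  have h0 := h ((r : ℝ), (s : ℝ))
  rw [Finset.sum_eq_single I] at h0
  · rw [Set.indicator_of_mem ((mem_rankSupport r s).2
      ⟨(hrx I hIS).trans (hxs I hIS), hrI, hsI⟩), mul_one] at h0
    exact haI h0
  · intro J hJ hJI
    by_cases haJ : a J = 0
    · rw [haJ, zero_mul]
    · rw [Set.indicator_of_notMem, mul_zero]
      intro hmem
      obtain ⟨-, h1, h2⟩ := (mem_rankSupport r s).1 hmem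
      exact hxJ J hJ haJ hJI (J.2.out h1 h2 ⟨hrx J hJ, hxs J hJ⟩)
  · intro h'
    exact absurd hIS h'

/-- Krull–Schmidt: two barcodes of the same module, padded to the same index set, differ by a
permutation. -/
theorem IsPaddedBarcode.exists_perm {J : Type*} [Fintype J] {M : PersistenceModule k c d}
    {α β : J → IndexInterval c d} (hα : IsPaddedBarcode M α) (hβ : IsPaddedBarcode M β) :
    ∃ e : J ≃ J, β ∘ e = α := by
  classical
  let S : Finset (IndexInterval c d) := Finset.univ.image α ∪ Finset.univ.image β
  have hαS : ∀ j, α j ∈ S := fun j =>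
    Finset.mem_union_left _ (Finset.mem_image_of_mem α (Finset.mem_univ j))
  have hβS : ∀ j, β j ∈ S := fun j =>
    Finset.mem_union_right _ (Finset.mem_image_of_mem β (Finset.mem_univ j))
  let cnt : (J → IndexInterval c d) → IndexInterval c d → ℕ := fun γ I =>
    (Finset.univ.filter fun j => γ j = I).card
  have hfib : ∀ γ : J → IndexInterval c d, (∀ j, γ j ∈ S) → ∀ f : IndexInterval c d → ℝ,
      ∑ j, f (γ j) = ∑ I ∈ S, (cnt γ I : ℝ) * f I := by
    intro γ hγ f
    rw [← Finset.sum_fiberwise_of_maps_to (s := Finset.univ) (t := S) (g := γ) fun j _ => hγ j]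
    refine Finset.sum_congr rfl fun I _ => ?_
    rw [Finset.sum_congr rfl fun j hj => by rw [(Finset.mem_filter.1 hj).2], Finset.sum_const,
      nsmul_eq_mul]
  have hcount : ∀ I ∈ S, cnt α I = cnt β I := by
    have hne : ∀ I ∈ S, I.1.Nonempty → cnt α I = cnt β I := by
      intro I hI hIne
      have h := eq_zero_of_sum_indicator_eq_zero (S.filter fun I => I.1.Nonempty)
        (fun I hI => (Finset.mem_filter.1 hI).2) (fun I => (cnt α I : ℝ) - cnt β I) (fun p => ?_) I
        (Finset.mem_filter.2 ⟨hI, hIne⟩)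
      · exact_mod_cast sub_eq_zero.1 h
      · have h1 := (hα.rankFunction_eq p).symm.trans (hβ.rankFunction_eq p)
        rw [hfib α hαS fun I => (rankSupport I).indicator (fun _ => (1 : ℝ)) p,
          hfib β hβS fun I => (rankSupport I).indicator (fun _ => (1 : ℝ)) p] at h1
        rw [Finset.sum_filter_of_ne]
        · simp only [sub_mul, Finset.sum_sub_distrib]
          rw [h1, sub_self]
        · intro I _ h2
          by_contra h3
          rw [eq_diagonalPoint h3, rankSupport_diagonalPoint] at h2
          simp at h2
    intro I hI
    by_cases hIne : I.1.Nonempty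
    · exact hne I hI hIne
    -- The empty interval is invisible to ranks; its multiplicity is what remains of the cardinality
    -- of `J`.
    · have h1 := (hfib α hαS fun _ => 1).symm.trans (hfib β hβS fun _ => 1)
      rw [← Finset.add_sum_erase S _ hI, ← Finset.add_sum_erase S _ hI] at h1
      have h2 : ∑ I' ∈ S.erase I, (cnt α I' : ℝ) * 1 = ∑ I' ∈ S.erase I, (cnt β I' : ℝ) * 1 := by
        refine Finset.sum_congr rfl fun I' hI' => ?_
        obtain ⟨h3, h4⟩ := Finset.mem_erase.1 hI'
        rw [hne I' h4 ?_]
        by_contra h5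
        exact h3 ((eq_diagonalPoint h5).trans (eq_diagonalPoint hIne).symm)
      rw [h2] at h1
      simpa using h1
  have hall : ∀ I, cnt α I = cnt β I := by
    intro I
    by_cases hI : I ∈ S
    · exact hcount I hI
    · have h0 : ∀ γ : J → IndexInterval c d, (∀ j, γ j ∈ S) → cnt γ I = 0 := fun γ hγ =>
        Finset.card_eq_zero.2 (Finset.filter_eq_empty_iff.2 fun j _ h => hI (h ▸ hγ j))
      rw [h0 α hαS, h0 β hβS]
  have heq : ∀ I, Nonempty ({j // α j = I} ≃ {j // β j = I}) := fun I => by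
    refine ⟨Fintype.equivOfCardEq ?_⟩
    rw [Fintype.card_subtype, Fintype.card_subtype]
    exact hall I
  refine ⟨Equiv.ofFiberEquiv fun I => (heq I).some, funext fun j => ?_⟩
  exact Equiv.ofFiberEquiv_map _ j

end Barcodes

/-! ### Areas swept by births, deaths and free generators. -/

section Geometry

variable {k : Type u} [Field k] {c d : ℝ}

/-- The interval `{t ∈ [c, d] : x ≤ t < y}`. -/
def halfOpenInterval (c d x y : ℝ) : IndexInterval c d :=
  ⟨{t | x ≤ (t : ℝ) ∧ (t : ℝ) < y}, ⟨fun _ hr _ hs _ ht =>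
    ⟨le_trans (α := ℝ) hr.1 ht.1, lt_of_le_of_lt (α := ℝ) ht.2 hs.2⟩⟩⟩

theorem mem_rankSupport_iff {I : IndexInterval c d} {p : ℝ × ℝ} :
    p ∈ rankSupport I ↔ p.1 ≤ p.2 ∧ (∃ h : p.1 ∈ Set.Icc c d, ⟨p.1, h⟩ ∈ I.1) ∧
      ∃ h : p.2 ∈ Set.Icc c d, ⟨p.2, h⟩ ∈ I.1 := by
  simp [rankSupport]

theorem mem_rankSupport_freeInterval {x : ℝ} {p : ℝ × ℝ} :
    p ∈ rankSupport (freeInterval c d x) ↔ p.1 ≤ p.2 ∧ c ≤ p.1 ∧ p.2 ≤ d ∧ x ≤ p.1 := by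
  rw [mem_rankSupport_iff]
  constructor
  · rintro ⟨h, ⟨h1, h2⟩, ⟨h3, -⟩⟩
    exact ⟨h, h1.1, h3.2, h2⟩
  · rintro ⟨h, h1, h2, h3⟩
    exact ⟨h, ⟨⟨h1, h.trans h2⟩, h3⟩, ⟨⟨h1.trans h, h2⟩, h3.trans h⟩⟩

theorem mem_rankSupport_halfOpenInterval {x y : ℝ} {p : ℝ × ℝ} :
    p ∈ rankSupport (halfOpenInterval c d x y) ↔
      (p.1 ≤ p.2 ∧ c ≤ p.1 ∧ p.2 ≤ d ∧ x ≤ p.1) ∧ p.2 < y := by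
  rw [mem_rankSupport_iff]
  constructor
  · rintro ⟨h, ⟨h1, h2⟩, ⟨h3, h4⟩⟩
    exact ⟨⟨h, h1.1, h3.2, h2.1⟩, h4.2⟩
  · rintro ⟨⟨h, h1, h2, h3⟩, h4⟩
    exact ⟨h, ⟨⟨h1, h.trans h2⟩, h3, lt_of_le_of_lt h h4⟩, ⟨⟨h1.trans h, h2⟩, h3.trans h, h4⟩⟩

theorem rankDiff_le_of_imp {c' d' : ℝ} {I J : IndexInterval c d} {I' J' : IndexInterval c' d'}
    {p : ℝ × ℝ} (h : (p ∈ rankSupport I' ↔ p ∈ rankSupport J') →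
      (p ∈ rankSupport I ↔ p ∈ rankSupport J)) : rankDiff I J p ≤ rankDiff I' J' p := by
  classical
  rw [rankDiff_eq, rankDiff_eq]
  split_ifs with h1 h2 h2
  · exact le_rfl
  · exact zero_le_one
  · exact absurd (h h2) h1
  · exact le_rfl

/-- Truncation at `y` intersects both free supports with the same half-plane, which can only shrink
their symmetric difference. -/
theorem dRk_halfOpenInterval_left_le (x x' y : ℝ) :
    dRk k (halfOpenInterval c d x y) (halfOpenInterval c d x' y) ≤
      dRk k (freeInterval c d x) (freeInterval c d x') := by
  rw [dRk_eq_lintegral, dRk_eq_lintegral]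
  refine lintegral_mono fun p => rankDiff_le_of_imp fun h => ?_
  simp only [mem_rankSupport_freeInterval] at h
  simp only [mem_rankSupport_halfOpenInterval, h]

theorem volume_le_lintegral_rankDiff {S : Set (ℝ × ℝ)} (hS : MeasurableSet S)
    {f : ℝ × ℝ → ℝ≥0∞} (h : ∀ p ∈ S, 1 ≤ f p) : volume S ≤ ∫⁻ p, f p := by
  rw [← lintegral_indicator_one hS]
  refine lintegral_mono fun p => ?_
  by_cases hp : p ∈ S
  · rw [Set.indicator_of_mem hp]
    exact h p hp
  · rw [Set.indicator_of_notMem hp]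
    exact zero_le

theorem lintegral_rankDiff_le_volume {S : Set (ℝ × ℝ)} (hS : MeasurableSet S)
    {I J : IndexInterval c d} (h : ∀ p, p ∉ S → (p ∈ rankSupport I ↔ p ∈ rankSupport J)) :
    ∫⁻ p, rankDiff I J p ≤ volume S := by
  rw [← lintegral_indicator_one hS]
  refine lintegral_mono fun p => ?_
  rw [rankDiff_eq]
  by_cases hp : p ∈ S
  · rw [Set.indicator_of_mem hp]
    split_ifs
    · exact zero_le
    · exact le_rfl
  · rw [Set.indicator_of_notMem hp, if_pos (h p hp)]

/-- Area comparison of the strips swept by the death and by the birth of a class. -/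
theorem volume_strip_le {a d y y' : ℝ} (h : 2 * y' ≤ d + a) :
    volume {p : ℝ × ℝ | a ≤ p.1 ∧ p.1 ≤ p.2 ∧ y ≤ p.2 ∧ p.2 < y'} ≤
      volume {p : ℝ × ℝ | y ≤ p.1 ∧ p.1 < y' ∧ p.1 ≤ p.2 ∧ p.2 ≤ d} := by
  have hm1 : MeasurableSet {p : ℝ × ℝ | a ≤ p.1 ∧ p.1 ≤ p.2 ∧ y ≤ p.2 ∧ p.2 < y'} :=
    (measurableSet_le measurable_const measurable_fst).inter
      ((measurableSet_le measurable_fst measurable_snd).inter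
      ((measurableSet_le measurable_const measurable_snd).inter
      (measurableSet_lt measurable_snd measurable_const)))
  have hm2 : MeasurableSet {p : ℝ × ℝ | y ≤ p.1 ∧ p.1 < y' ∧ p.1 ≤ p.2 ∧ p.2 ≤ d} :=
    (measurableSet_le measurable_const measurable_fst).inter
      ((measurableSet_lt measurable_fst measurable_const).inter
      ((measurableSet_le measurable_fst measurable_snd).inter
      (measurableSet_le measurable_snd measurable_const)))
  -- Slice the first strip horizontally and the second vertically, at the same `u`: the lengths are
  -- `u - a` and `d - u`, and `u < y' ≤ (a + d) / 2`.
  rw [Measure.volume_eq_prod, Measure.prod_apply_symm hm1, Measure.prod_apply hm2]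
  refine lintegral_mono fun u => ?_
  by_cases hu : y ≤ u ∧ u < y'
  · have h1 : (fun r : ℝ => (r, u)) ⁻¹' {p : ℝ × ℝ | a ≤ p.1 ∧ p.1 ≤ p.2 ∧ y ≤ p.2 ∧ p.2 < y'} =
        Set.Icc a u := by
      ext r
      simp [hu]
    have h2 : Prod.mk u ⁻¹' {p : ℝ × ℝ | y ≤ p.1 ∧ p.1 < y' ∧ p.1 ≤ p.2 ∧ p.2 ≤ d} =
        Set.Icc u d := by
      ext r
      simp [hu]
    rw [h1, h2, Real.volume_Icc, Real.volume_Icc]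
    exact ENNReal.ofReal_le_ofReal (by linarith [hu.2])
  · have h1 : (fun r : ℝ => (r, u)) ⁻¹' {p : ℝ × ℝ | a ≤ p.1 ∧ p.1 ≤ p.2 ∧ y ≤ p.2 ∧ p.2 < y'} =
        ∅ := by
      ext r
      simp only [Set.mem_preimage, Set.mem_ofPred_eq, Set.mem_empty_iff_false, iff_false]
      exact fun h => hu h.2.2
    rw [h1, measure_empty]
    exact zero_le

/-- The only place where the upper bound depends on `2 * b - a ≤ d`. The difference of the two bars
lies in a horizontal strip to the right of `a`, and the free modules differ on a vertical strip
reaching up to `d`. -/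
theorem dRk_halfOpenInterval_right_le {a b x y y' : ℝ} (hca : c ≤ a) (hd : 2 * b - a ≤ d)
    (hx : a ≤ x) (hy : y ∈ Set.Icc a b) (hy' : y' ∈ Set.Icc a b) :
    dRk k (halfOpenInterval c d x y) (halfOpenInterval c d x y') ≤
      dRk k (freeInterval c d y) (freeInterval c d y') := by
  wlog hyy : y ≤ y' generalizing y y'
  · rw [dRk_comm, dRk_comm (k := k) (freeInterval c d y)]
    exact this hy' hy (le_of_not_ge hyy)
  rw [dRk_eq_lintegral, dRk_eq_lintegral]
  have hm1 : MeasurableSet {p : ℝ × ℝ | a ≤ p.1 ∧ p.1 ≤ p.2 ∧ y ≤ p.2 ∧ p.2 < y'} :=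
    (measurableSet_le measurable_const measurable_fst).inter
      ((measurableSet_le measurable_fst measurable_snd).inter
      ((measurableSet_le measurable_const measurable_snd).inter
      (measurableSet_lt measurable_snd measurable_const)))
  have hm2 : MeasurableSet {p : ℝ × ℝ | y ≤ p.1 ∧ p.1 < y' ∧ p.1 ≤ p.2 ∧ p.2 ≤ d} :=
    (measurableSet_le measurable_const measurable_fst).inter
      ((measurableSet_lt measurable_fst measurable_const).inter
      ((measurableSet_le measurable_fst measurable_snd).inter
      (measurableSet_le measurable_snd measurable_const)))
  refine (lintegral_rankDiff_le_volume hm1 fun p hp => ?_).trans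
    ((volume_strip_le (by linarith [hy'.2])).trans
      (volume_le_lintegral_rankDiff hm2 fun p hp => ?_))
  · simp only [mem_rankSupport_halfOpenInterval]
    simp only [Set.mem_ofPred_eq, not_and, not_lt] at hp
    constructor
    · exact fun h => ⟨h.1, h.2.trans_le hyy⟩
    · intro h
      refine ⟨h.1, ?_⟩
      by_contra h'
      exact absurd h.2 (not_lt.2 (hp (hx.trans h.1.2.2.2) h.1.1 (not_lt.1 h')))
  · obtain ⟨h1, h2, h3, h4⟩ := hp
    rw [rankDiff_eq, if_neg]
    simp only [mem_rankSupport_freeInterval]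
    intro h
    exact absurd (h.1 ⟨h3, hca.trans (hy.1.trans h1), h4, h1⟩).2.2.2 (not_le.2 h2)

theorem dRk_halfOpenInterval_le {a b x y x' y' : ℝ} (hca : c ≤ a) (hd : 2 * b - a ≤ d)
    (hx' : a ≤ x') (hy : y ∈ Set.Icc a b) (hy' : y' ∈ Set.Icc a b) :
    dRk k (halfOpenInterval c d x y) (halfOpenInterval c d x' y') ≤
      dRk k (freeInterval c d x) (freeInterval c d x') +
        dRk k (freeInterval c d y) (freeInterval c d y') :=
  (dRk_triangle _ (halfOpenInterval c d x' y) _).trans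
    (add_le_add (dRk_halfOpenInterval_left_le x x' y)
      (dRk_halfOpenInterval_right_le hca hd hx' hy hy'))

/-- Free supports are nested, so the two successive differences are disjoint. Equality is needed:
the triangle inequality points the wrong way for concatenating upper bounds. -/
theorem dRk_freeInterval_add {x y z : ℝ} (h : x ≤ y ∧ y ≤ z ∨ z ≤ y ∧ y ≤ x) :
    dRk k (freeInterval c d x) (freeInterval c d z) =
      dRk k (freeInterval c d x) (freeInterval c d y) +
        dRk k (freeInterval c d y) (freeInterval c d z) := by
  wlog hxy : x ≤ y ∧ y ≤ z generalizing x z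
  · rw [dRk_comm, dRk_comm (freeInterval c d x) (freeInterval c d y),
      dRk_comm (freeInterval c d y) (freeInterval c d z), add_comm]
    exact this h.symm (h.resolve_left hxy)
  simp only [dRk_eq_lintegral]
  rw [← lintegral_add_left (measurable_rankDiff _ _)]
  refine lintegral_congr fun p => ?_
  simp only [rankDiff_eq, mem_rankSupport_freeInterval]
  by_cases h0 : p.1 ≤ p.2 ∧ c ≤ p.1 ∧ p.2 ≤ d
  · obtain ⟨h1, h2, h3⟩ := h0
    simp only [h1, h2, h3, true_and]
    by_cases hz : z ≤ p.1
    · simp [hz, hxy.2.trans hz, hxy.1.trans (hxy.2.trans hz)]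
    · by_cases hy : y ≤ p.1
      · simp [hz, hy, hxy.1.trans hy]
      · simp [hz, hy]
  · have h1 : ∀ q : ℝ, ¬ (p.1 ≤ p.2 ∧ c ≤ p.1 ∧ p.2 ≤ d ∧ q ≤ p.1) := fun q hq =>
      h0 ⟨hq.1, hq.2.1, hq.2.2.1⟩
    simp [h1]

/-- The supports over the small window are those over the large one cut by a common region. -/
theorem dRk_freeInterval_mono {c' d' x y : ℝ} (hc : c' ≤ c) (hd : d ≤ d') :
    dRk k (freeInterval c d x) (freeInterval c d y) ≤
      dRk k (freeInterval c' d' x) (freeInterval c' d' y) := by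
  rw [dRk_eq_lintegral, dRk_eq_lintegral]
  refine lintegral_mono fun p => rankDiff_le_of_imp fun h => ?_
  simp only [mem_rankSupport_freeInterval] at h ⊢
  constructor
  · rintro ⟨h1, h2, h3, h4⟩
    exact ⟨h1, h2, h3, (h.1 ⟨h1, hc.trans h2, h3.trans hd, h4⟩).2.2.2⟩
  · rintro ⟨h1, h2, h3, h4⟩
    exact ⟨h1, h2, h3, (h.2 ⟨h1, hc.trans h2, h3.trans hd, h4⟩).2.2.2⟩

end Geometry

/-! ### Stability: matching by cells, then interpolation between weights. -/

namespace CellComplex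

variable {k : Type u} [Field k] {K : CellComplex k} {c d : ℝ}

namespace NormalForm

variable {N : K.NormalForm} {w v : K.Cell →o ℝ} {i : ℕ}

theorem bar_of_ne {τ : K.Cell} (h : ¬ (K.dim τ = i ∧ N.p.symm τ = none)) :
    N.bar w c d i τ = diagonalPoint c d :=
  Subtype.ext (Set.eq_empty_iff_forall_notMem.2 fun _ ht => h ⟨ht.1, ht.2.1⟩)

theorem bar_of_none {τ : K.Cell} (h : K.dim τ = i ∧ N.p.symm τ = none) (hp : N.p τ = none) :
    N.bar w c d i τ = freeInterval c d (w τ) :=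
  Subtype.ext (Set.ext fun _ => ⟨fun ht => ht.2.2.1, fun ht => ⟨h.1, h.2, ht, fun σ hσ => by
    rw [hp] at hσ
    cases hσ⟩⟩)

theorem bar_of_some {σ τ : K.Cell} (h : K.dim τ = i ∧ N.p.symm τ = none) (hp : N.p τ = some σ) :
    N.bar w c d i τ = halfOpenInterval c d (w τ) (w σ) :=
  Subtype.ext (Set.ext fun _ => ⟨fun ht => ⟨ht.2.2.1, ht.2.2.2 σ hp⟩,
    fun ht => ⟨h.1, h.2, ht.1, fun σ' hσ' => by
      rw [hp] at hσ'
      rw [← Option.some.inj hσ']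
      exact ht.2⟩⟩)

theorem isPaddedBarcode (hN : N.IsAdapted w) (i : ℕ) :
    IsPaddedBarcode (K.persistentHomology w c d i) (N.bar w c d i) :=
  fun _ g hg hr => N.isBarcode hN g hg hr

open Classical in
/-- The cells whose weight is an end of a bar in degree `i`. -/
def charge (N : K.NormalForm) (i : ℕ) (f : K.Cell → ℝ≥0∞) (σ : K.Cell) : ℝ≥0∞ :=
  if (K.dim σ = i ∧ N.p.symm σ = none) ∨ (K.dim σ = i + 1 ∧ N.p.symm σ ≠ none) then f σ else 0

theorem charge_le (N : K.NormalForm) (i : ℕ) (f : K.Cell → ℝ≥0∞) :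
    ∑ σ, N.charge i f σ ≤ ∑ σ with K.dim σ = i ∨ K.dim σ = i + 1, f σ := by
  classical
  rw [Finset.sum_filter]
  refine Finset.sum_le_sum fun σ _ => ?_
  rw [charge]
  split_ifs with h1 h2
  · exact le_rfl
  · exact absurd (h1.imp And.left And.left) h2
  · exact zero_le
  · exact le_rfl

/-- A cell is charged in one degree only: a birth in its own dimension, a death one below. -/
theorem tsum_charge_le (N : K.NormalForm) (f : K.Cell → ℝ≥0∞) :
    ∑' i, ∑ σ, N.charge i f σ ≤ ∑ σ, f σ := by
  classical
  rw [Summable.tsum_finsetSum fun _ _ => ENNReal.summable]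
  refine Finset.sum_le_sum fun σ _ => ?_
  obtain ⟨j, hj⟩ : ∃ j, ∀ i, i ≠ j → N.charge i f σ = 0 := by
    by_cases h : N.p.symm σ = none
    · refine ⟨K.dim σ, fun i hi => if_neg ?_⟩
      rintro (h1 | h1)
      · exact hi h1.1.symm
      · exact h1.2 h
    · refine ⟨K.dim σ - 1, fun i hi => if_neg ?_⟩
      rintro (h1 | h1)
      · exact h h1.2
      · omega
  rw [tsum_eq_single j hj, charge]
  split_ifs
  · exact le_rfl
  · exact zero_le

/-- Both weights share the pairing, so the bar of `τ` keeps its two end cells and its cost splits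
between them. Exchanging the sums collects the charges cell by cell, each death having a single
partner. -/
theorem sum_dRk_bar_le {a b : ℝ} (hca : c ≤ a) (hd : 2 * b - a ≤ d)
    (hw : ∀ σ, w σ ∈ Set.Icc a b) (hv : ∀ σ, v σ ∈ Set.Icc a b) (i : ℕ) :
    ∑ τ, dRk k (N.bar w c d i τ) (N.bar v c d i τ) ≤ ∑ σ, N.charge i (K.cellDist w v c d) σ := by
  classical
  have hterm : ∀ τ, dRk k (N.bar w c d i τ) (N.bar v c d i τ) ≤
      (if K.dim τ = i ∧ N.p.symm τ = none then K.cellDist w v c d τ else 0) +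
      ∑ σ, if N.p τ = some σ ∧ K.dim τ = i then K.cellDist w v c d σ else 0 := by
    intro τ
    by_cases h : K.dim τ = i ∧ N.p.symm τ = none
    · rw [if_pos h]
      cases hp : N.p τ with
      | none =>
        rw [bar_of_none h hp, bar_of_none h hp]
        exact le_self_add
      | some σ =>
        rw [bar_of_some h hp, bar_of_some h hp]
        refine (dRk_halfOpenInterval_le hca hd (hv τ).1 (hw σ) (hv σ)).trans
          (add_le_add le_rfl ?_)
        refine le_trans (le_of_eq ?_) (Finset.single_le_sum
          (f := fun σ' => if some σ = some σ' ∧ K.dim τ = i then K.cellDist w v c d σ' else 0)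
          (fun _ _ => zero_le) (Finset.mem_univ σ))
        exact (if_pos ⟨rfl, h.1⟩).symm
    · rw [bar_of_ne h, bar_of_ne h, dRk_self]
      exact zero_le
  refine (Finset.sum_le_sum fun τ _ => hterm τ).trans ?_
  rw [Finset.sum_add_distrib, Finset.sum_comm (f := fun τ σ =>
    if N.p τ = some σ ∧ K.dim τ = i then K.cellDist w v c d σ else 0), ← Finset.sum_add_distrib]
  refine Finset.sum_le_sum fun σ _ => ?_
  cases h : N.p.symm σ with
  | none =>
    have h1 : ∀ τ, ¬ (N.p τ = some σ ∧ K.dim τ = i) := fun τ hτ => by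
      rw [N.symm_of_some hτ.1] at h
      cases h
    simp [h1, charge, h]
  | some ρ =>
    have hρ := N.p_of_symm h
    rw [Finset.sum_eq_single ρ]
    · have hdim := N.dim_of_some hρ
      have h2 : K.dim ρ = i ↔ K.dim σ = i + 1 := by omega
      simp [charge, h, hρ, h2]
    · intro τ _ hτ
      refine if_neg fun h1 => hτ ?_
      rw [N.symm_of_some h1.1] at h
      exact Option.some.inj h
    · intro h'
      exact absurd (Finset.mem_univ ρ) h'

end NormalForm

/-- The barcodes of `w` and `v`, indexed by the cells, can be matched within the bounds of the
stability inequalities. -/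
def HasBoundedMatching (K : CellComplex k) (w v : K.Cell →o ℝ) (c d : ℝ) : Prop :=
  ∃ α β : ℕ → K.Cell → IndexInterval c d,
    (∀ i, IsPaddedBarcode (K.persistentHomology w c d i) (α i)) ∧
    (∀ i, IsPaddedBarcode (K.persistentHomology v c d i) (β i)) ∧
    (∑' i, ∑ σ, dRk k (α i σ) (β i σ) ≤ ∑ σ, K.cellDist w v c d σ) ∧
    ∀ i, ∑ σ, dRk k (α i σ) (β i σ) ≤
      ∑ σ with K.dim σ = i ∨ K.dim σ = i + 1, K.cellDist w v c d σ

theorem HasBoundedMatching.barcodeBound {w v : K.Cell →o ℝ} (h : K.HasBoundedMatching w v c d) :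
    K.BarcodeBound w v c d := by
  obtain ⟨α, β, hα, hβ, h1, h2⟩ := h
  exact ⟨(ENNReal.tsum_le_tsum fun i => wassersteinRk_le_sum (hα i) (hβ i)).trans h1,
    fun i => (wassersteinRk_le_sum (hα i) (hβ i)).trans (h2 i)⟩

/-- The middle weight comes with two barcodes, one from each matching; uniqueness aligns them by a
permutation of the cells, and the triangle inequality applies bar by bar. -/
theorem HasBoundedMatching.trans {w u v : K.Cell →o ℝ} (h : K.HasBoundedMatching w u c d)
    (h' : K.HasBoundedMatching u v c d)
    (hadd : ∀ σ, K.cellDist w v c d σ = K.cellDist w u c d σ + K.cellDist u v c d σ) :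
    K.HasBoundedMatching w v c d := by
  obtain ⟨α, β, hα, hβ, h1, h2⟩ := h
  obtain ⟨α', β', hα', hβ', h1', h2'⟩ := h'
  choose e he using fun i => (hβ i).exists_perm (hα' i)
  have hle : ∀ i, ∑ σ, dRk k (α i σ) ((β' i ∘ e i) σ) ≤
      ∑ σ, dRk k (α i σ) (β i σ) + ∑ σ, dRk k (α' i σ) (β' i σ) := by
    intro i
    rw [← Equiv.sum_comp (e i) fun σ => dRk k (α' i σ) (β' i σ), ← Finset.sum_add_distrib]
    refine Finset.sum_le_sum fun σ _ => ?_
    rw [← he i]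
    exact dRk_triangle _ _ _
  refine ⟨α, fun i => β' i ∘ e i, hα, fun i => (hβ' i).comp_equiv (e i), ?_, fun i => ?_⟩
  · refine (ENNReal.tsum_le_tsum hle).trans ?_
    rw [ENNReal.tsum_add]
    refine (add_le_add h1 h1').trans (le_of_eq ?_)
    rw [← Finset.sum_add_distrib]
    exact Finset.sum_congr rfl fun σ _ => (hadd σ).symm
  · refine (hle i).trans ((add_le_add (h2 i) (h2' i)).trans (le_of_eq ?_))
    rw [← Finset.sum_add_distrib]
    exact Finset.sum_congr rfl fun σ _ => (hadd σ).symm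

theorem hasBoundedMatching_of_forall_le {a b : ℝ} (hca : c ≤ a) (hd : 2 * b - a ≤ d)
    {w v : K.Cell →o ℝ} (hw : ∀ σ, w σ ∈ Set.Icc a b) (hv : ∀ σ, v σ ∈ Set.Icc a b)
    (h : ∀ σ τ, w σ < w τ → v σ ≤ v τ) : K.HasBoundedMatching w v c d := by
  obtain ⟨N, hNw, hNv⟩ := K.exists_normalForm w v h
  exact ⟨fun i => N.bar w c d i, fun i => N.bar v c d i, N.isPaddedBarcode hNw,
    N.isPaddedBarcode hNv,
    (ENNReal.tsum_le_tsum fun i => NormalForm.sum_dRk_bar_le hca hd hw hv i).trans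
      (N.tsum_charge_le _),
    fun i => (NormalForm.sum_dRk_bar_le hca hd hw hv i).trans (N.charge_le i _)⟩

theorem cellDist_add {w u v : K.Cell →o ℝ} {σ : K.Cell}
    (h : w σ ≤ u σ ∧ u σ ≤ v σ ∨ v σ ≤ u σ ∧ u σ ≤ w σ) :
    K.cellDist w v c d σ = K.cellDist w u c d σ + K.cellDist u v c d σ :=
  dRk_freeInterval_add h

/-- The weight `(1 - t) w + t v`. -/
def interpolate (w v : K.Cell →o ℝ) (t : ℝ) (h0 : 0 ≤ t) (h1 : t ≤ 1) : K.Cell →o ℝ where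
  toFun σ := (1 - t) * w σ + t * v σ
  monotone' _ _ h := add_le_add (mul_le_mul_of_nonneg_left (w.monotone h) (sub_nonneg.2 h1))
    (mul_le_mul_of_nonneg_left (v.monotone h) h0)

/-- Stability, by induction on the number of pairs of cells that the weights order in opposite
ways. -/
theorem hasBoundedMatching {a b : ℝ} (hca : c ≤ a) (hd : 2 * b - a ≤ d)
    (w v : K.Cell →o ℝ) (hw : ∀ σ, w σ ∈ Set.Icc a b) (hv : ∀ σ, v σ ∈ Set.Icc a b) :
    K.HasBoundedMatching w v c d := by
  classical
  let inv : (K.Cell →o ℝ) → Finset (K.Cell × K.Cell) := fun w =>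
    Finset.univ.filter fun x => w x.1 < w x.2 ∧ v x.2 < v x.1
  have hinv : ∀ w x, x ∈ inv w ↔ w x.1 < w x.2 ∧ v x.2 < v x.1 := fun w x => by simp [inv]
  induction hn : (inv w).card using Nat.strong_induction_on generalizing w with
  | _ n ih =>
    rcases (inv w).eq_empty_or_nonempty with hempty | hne
    · refine hasBoundedMatching_of_forall_le hca hd hw hv fun σ τ hlt => ?_
      by_contra h
      have : (σ, τ) ∈ inv w := (hinv w _).2 ⟨hlt, not_le.1 h⟩
      rw [hempty] at this
      exact absurd this (Finset.notMem_empty _)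
    -- The time at which the interpolated values of an inverted pair coincide; the earliest such
    -- time is used.
    · let T : K.Cell × K.Cell → ℝ := fun x =>
        (w x.2 - w x.1) / ((w x.2 - w x.1) + (v x.1 - v x.2))
      obtain ⟨x, hx, hmin⟩ := Finset.exists_min_image (inv w) T hne
      obtain ⟨hx1, hx2⟩ := (hinv w x).1 hx
      set t := T x with ht
      have hpos : 0 < (w x.2 - w x.1) + (v x.1 - v x.2) := by linarith
      have htmul : t * ((w x.2 - w x.1) + (v x.1 - v x.2)) = w x.2 - w x.1 :=
        div_mul_cancel₀ _ hpos.ne'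
      have h0 : 0 < t := div_pos (by linarith) hpos
      have h1 : t < 1 := (div_lt_one hpos).2 (by linarith)
      let u := interpolate w v t h0.le h1.le
      have hu : ∀ σ, u σ = (1 - t) * w σ + t * v σ := fun _ => rfl
      have huI : ∀ σ, u σ ∈ Set.Icc a b := fun σ =>
        (convex_Icc a b) (hw σ) (hv σ) (sub_nonneg.2 h1.le) h0.le (by ring)
      -- Up to the first meeting time no strict inequality of `w` has been reversed.
      have hwu : K.HasBoundedMatching w u c d := by
        refine hasBoundedMatching_of_forall_le hca hd hw huI fun σ τ hlt => ?_
        rw [hu, hu]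
        by_cases hle : v σ ≤ v τ
        · exact add_le_add (mul_le_mul_of_nonneg_left hlt.le (sub_nonneg.2 h1.le))
            (mul_le_mul_of_nonneg_left hle h0.le)
        · have hlt' := not_le.1 hle
          have hm := hmin (σ, τ) ((hinv w _).2 ⟨hlt, hlt'⟩)
          have hpos' : 0 < (w τ - w σ) + (v σ - v τ) := by linarith
          have hm' : t * ((w τ - w σ) + (v σ - v τ)) ≤ w τ - w σ := (le_div_iff₀ hpos').1 hm
          linarith
      have huv : K.HasBoundedMatching u v c d := by
        refine ih (inv u).card ?_ u huI rfl
        rw [← hn]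
        -- Interpolation creates no new inversion, and the pair `x` has equal values at `u`, so it
        -- drops out.
        refine Finset.card_lt_card ⟨fun y hy => ?_, fun hsub => ?_⟩
        · obtain ⟨hy1, hy2⟩ := (hinv u y).1 hy
          refine (hinv w y).2 ⟨?_, hy2⟩
          rw [hu, hu] at hy1
          have h3 : 0 < t * (v y.1 - v y.2) := mul_pos h0 (by linarith)
          have h4 : 0 < (1 - t) * (w y.2 - w y.1) := by linarith
          have h5 := pos_of_mul_pos_right h4 (by linarith : 0 ≤ 1 - t)
          linarith
        · have h3 := ((hinv u x).1 (hsub hx)).1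
          rw [hu, hu] at h3
          linarith
      refine hwu.trans huv fun σ => cellDist_add ?_
      rw [hu]
      rcases le_total (w σ) (v σ) with hle | hle
      · have h3 := mul_nonneg h0.le (sub_nonneg.2 hle)
        have h4 := mul_nonneg (sub_nonneg.2 h1.le) (sub_nonneg.2 hle)
        exact Or.inl ⟨by linarith, by linarith⟩
      · have h3 := mul_nonneg h0.le (sub_nonneg.2 hle)
        have h4 := mul_nonneg (sub_nonneg.2 h1.le) (sub_nonneg.2 hle)
        exact Or.inr ⟨by linarith, by linarith⟩

end CellComplex

/-! ### The edge as a test complex: the upper endpoint is forced. -/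

section Edge

variable (k : Type u) [Field k]

/-- The nonempty subsets of `{0, …, n - 1}`, with the simplicial incidence coefficients. -/
def simplexInc (n : ℕ) (s t : {s : Finset (Fin n) // s.Nonempty}) : k :=
  ∑ v ∈ s.1, if t.1 = s.1.erase v then (-1) ^ (s.1.filter (· < v)).card else 0

variable {k}

theorem simplexInc_ne_zero {n : ℕ} {s t : {s : Finset (Fin n) // s.Nonempty}}
    (h : simplexInc k n s t ≠ 0) : t ≤ s ∧ s.1.card = t.1.card + 1 := by
  obtain ⟨v, hv, hne⟩ := Finset.exists_ne_zero_of_sum_ne_zero h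
  have ht : t.1 = s.1.erase v := by
    by_contra h'
    exact hne (if_neg h')
  constructor
  · change t.1 ⊆ s.1
    rw [ht]
    exact Finset.erase_subset v s.1
  · rw [ht, Finset.card_erase_add_one hv]

variable (k) in
/-- The simplicial complex of an edge and its two vertices. -/
def edgeComplex : CellComplex k where
  Cell := {s : Finset (Fin 2) // s.Nonempty}
  dim s := s.1.card - 1
  inc := simplexInc k 2
  face_of_inc _ _ h := (simplexInc_ne_zero h).1
  dim_of_inc s t h := by
    have h1 := (simplexInc_ne_zero h).2
    have h2 := t.2.card_pos
    omega
  inc_inc s r := by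
    -- Two successive facets of a simplex with a nonempty result would require three vertices.
    refine Finset.sum_eq_zero fun t _ => ?_
    by_contra h
    have h1 := (simplexInc_ne_zero (left_ne_zero_of_mul h)).2
    have h2 := (simplexInc_ne_zero (right_ne_zero_of_mul h)).2
    have h3 := r.2.card_pos
    have h4 := Finset.card_le_univ s.1
    rw [Fintype.card_fin] at h4
    omega

variable (k) in
theorem edgeComplex_isSimplicial : (edgeComplex k).IsSimplicial := by
  refine ⟨2, Subtype.val, Subtype.val_injective, fun σ => σ.2, fun σ s _ hs => ⟨⟨s, hs⟩, rfl⟩,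
    fun σ τ => Iff.rfl, fun σ => ?_, fun σ τ => rfl⟩
  have := σ.2.card_pos
  change σ.1.card = σ.1.card - 1 + 1
  omega

/-- The edge, as a cell of `edgeComplex`. -/
def edgeTop : (edgeComplex k).Cell := ⟨Finset.univ, Finset.univ_nonempty⟩

theorem eq_edgeTop {σ : (edgeComplex k).Cell} (h : (edgeComplex k).dim σ ≠ 0) :
    σ = edgeTop := by
  have h1 := Finset.card_le_univ σ.1
  have h2 : σ.1.card - 1 ≠ 0 := h
  rw [Fintype.card_fin] at h1
  refine Subtype.ext ((Finset.card_eq_iff_eq_univ σ.1).1 ?_)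
  rw [Fintype.card_fin]
  omega

theorem edgeTop_dim : (edgeComplex k).dim edgeTop = 1 := rfl

theorem edgeTop_inc : (edgeComplex k).inc edgeTop ⟨{1}, Finset.singleton_nonempty 1⟩ = 1 := by
  have h0 : ({1} : Finset (Fin 2)) = Finset.univ.erase 0 := by decide
  have h1 : ({1} : Finset (Fin 2)) ≠ Finset.univ.erase 1 := by decide
  have h2 : (Finset.univ.filter fun x : Fin 2 => x < 0).card = 0 := by decide
  change ∑ v : Fin 2, (if ({1} : Finset (Fin 2)) = Finset.univ.erase v then
    (-1 : k) ^ (Finset.univ.filter fun x : Fin 2 => x < v).card else 0) = 1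
  rw [Fin.sum_univ_two, if_neg h1, if_pos h0, add_zero]
  rw [h2, pow_zero]

/-- The edge is the death of a class in degree zero. -/
theorem exists_p_eq_edgeTop (N : (edgeComplex k).NormalForm) : ∃ τ, N.p τ = some edgeTop := by
  cases h : N.p.symm edgeTop with
  | some τ => exact ⟨τ, N.p_of_symm h⟩
  | none =>
    exfalso
    -- A chain of degree one is a multiple of the edge, whose boundary has coefficient one at the
    -- vertex `1`.
    have hF : ∀ σ, σ ≠ edgeTop → N.F edgeTop σ = 0 := by
      intro σ hσ
      by_contra h'
      refine hσ (eq_edgeTop ?_)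
      rw [N.dim_of_F _ _ h', edgeTop_dim]
      exact one_ne_zero
    have h0 : (edgeComplex k).boundary (N.F edgeTop) ⟨{1}, Finset.singleton_nonempty 1⟩ = 0 := by
      rw [N.boundary_of_none edgeTop h]
      rfl
    change ∑ σ, N.F edgeTop σ * (edgeComplex k).inc σ ⟨{1}, Finset.singleton_nonempty 1⟩ = 0 at h0
    rw [Finset.sum_eq_single edgeTop (fun σ _ hσ => by rw [hF σ hσ, zero_mul])
      (fun h' => absurd (Finset.mem_univ _) h'), edgeTop_inc, mul_one] at h0
    refine N.F_ne_zero edgeTop (funext fun σ => ?_)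
    by_cases hσ : σ = edgeTop
    · rw [hσ]
      exact h0
    · exact hF σ hσ

variable (k) in
/-- The weight that is `a` on the vertices and `y` on the edge. -/
def edgeWeight {a y : ℝ} (h : a ≤ y) : (edgeComplex k).Cell →o ℝ where
  toFun σ := if (edgeComplex k).dim σ = 0 then a else y
  monotone' σ τ hστ := by
    have h1 : σ.1.card - 1 ≤ τ.1.card - 1 := Nat.sub_le_sub_right (Finset.card_le_card hστ) 1
    change (if σ.1.card - 1 = 0 then a else y) ≤ (if τ.1.card - 1 = 0 then a else y)
    split_ifs with h2 h3 h3
    · exact le_rfl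
    · exact h
    · omega
    · exact le_rfl

theorem edgeWeight_of_dim {a y : ℝ} (h : a ≤ y) {σ : (edgeComplex k).Cell}
    (hσ : (edgeComplex k).dim σ = 0) : edgeWeight k h σ = a := if_pos hσ

theorem edgeWeight_top {a y : ℝ} (h : a ≤ y) : edgeWeight k h edgeTop = y := by
  change (if (edgeComplex k).dim edgeTop = 0 then a else y) = y
  rw [edgeTop_dim, if_neg one_ne_zero]

theorem edgeWeight_mem {a b y : ℝ} (h : a ≤ y) (hy : y ≤ b) (σ : (edgeComplex k).Cell) :
    edgeWeight k h σ ∈ Set.Icc a b := by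
  by_cases hσ : (edgeComplex k).dim σ = 0
  · rw [edgeWeight_of_dim h hσ]
    exact ⟨le_rfl, h.trans hy⟩
  · rw [eq_edgeTop hσ, edgeWeight_top]
    exact ⟨h, hy⟩

variable {c d : ℝ}

/-- Both weights are sorted by a common normal form. Delaying the edge lengthens the bar it kills
from `[a, y)` to `[a, y')` and shrinks no bar of degree zero, so nothing cancels the gain on the
rectangle. -/
theorem one_le_abs_rankFunction_sub {a y y' : ℝ} (hca : c ≤ a) (hy : a ≤ y) (hyy : y ≤ y')
    (hd : y' ≤ d) {p : ℝ × ℝ} (hp : p ∈ Set.Icc a y ×ˢ Set.Ico y y') :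
    1 ≤ |rankFunction ((edgeComplex k).persistentHomology (edgeWeight k hy) c d 0) p -
      rankFunction ((edgeComplex k).persistentHomology (edgeWeight k (hy.trans hyy)) c d 0) p| := by
  obtain ⟨⟨hp1, hp2⟩, hp3, hp4⟩ := hp
  obtain ⟨N, hN, hN'⟩ := (edgeComplex k).exists_normalForm (edgeWeight k hy)
    (edgeWeight k (hy.trans hyy)) (fun σ τ h => by
      by_cases hσ : (edgeComplex k).dim σ = 0
      · rw [edgeWeight_of_dim _ hσ]
        exact (edgeWeight_mem (hy.trans hyy) le_rfl τ).1
      · rw [eq_edgeTop hσ, edgeWeight_top] at h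
        exact absurd (edgeWeight_mem hy le_rfl τ).2 (not_le.2 h))
  obtain ⟨τ, hτ⟩ := exists_p_eq_edgeTop N
  have hdim : (edgeComplex k).dim τ = 0 := by
    have h := N.dim_of_some hτ
    rw [edgeTop_dim] at h
    omega
  have hdeath : N.p.symm τ = none := by
    cases h : N.p.symm τ with
    | none => rfl
    | some ρ =>
      have h' := N.p_of_death (N.p_of_symm h)
      rw [hτ] at h'
      cases h'
  rw [IsPaddedBarcode.rankFunction_eq (N.isPaddedBarcode hN 0),
    IsPaddedBarcode.rankFunction_eq (N.isPaddedBarcode hN' 0), abs_sub_comm, ← Finset.sum_sub_distrib]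
  refine le_trans ?_ (le_abs_self _)
  have hone : (1 : ℝ) = (rankSupport (N.bar (edgeWeight k (hy.trans hyy)) c d 0 τ)).indicator
      (fun _ => (1 : ℝ)) p -
      (rankSupport (N.bar (edgeWeight k hy) c d 0 τ)).indicator (fun _ => (1 : ℝ)) p := by
    rw [CellComplex.NormalForm.bar_of_some ⟨hdim, hdeath⟩ hτ, CellComplex.NormalForm.bar_of_some ⟨hdim, hdeath⟩ hτ,
      edgeWeight_of_dim _ hdim, edgeWeight_of_dim _ hdim, edgeWeight_top, edgeWeight_top,
      Set.indicator_of_mem, Set.indicator_of_notMem, sub_zero]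
    · rw [mem_rankSupport_halfOpenInterval]
      exact fun h => absurd h.2 (not_lt.2 hp3)
    · rw [mem_rankSupport_halfOpenInterval]
      exact ⟨⟨hp2.trans hp3, hca.trans hp1, hp4.le.trans hd, hp1⟩, hp4⟩
  refine hone.le.trans ?_
  refine Finset.single_le_sum (f := fun τ =>
    (rankSupport (N.bar (edgeWeight k (hy.trans hyy)) c d 0 τ)).indicator (fun _ => (1 : ℝ)) p -
      (rankSupport (N.bar (edgeWeight k hy) c d 0 τ)).indicator (fun _ => (1 : ℝ)) p)
    (fun σ _ => ?_) (Finset.mem_univ τ)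
  refine sub_nonneg.2 (Set.indicator_le_indicator_of_subset ?_ (fun _ => zero_le_one) p)
  rintro q ⟨h1, ⟨r, hr, hr'⟩, ⟨s, hs, hs'⟩⟩
  have hsub : ∀ t : Set.Icc c d, t ∈ (N.bar (edgeWeight k hy) c d 0 σ).1 →
      t ∈ (N.bar (edgeWeight k (hy.trans hyy)) c d 0 σ).1 := by
    rintro t ⟨ht1, ht2, ht3, ht4⟩
    refine ⟨ht1, ht2, ?_, fun ρ hρ => (ht4 ρ hρ).trans_le ?_⟩
    · rw [edgeWeight_of_dim _ ht1] at ht3 ⊢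
      exact ht3
    · have h := N.dim_of_some hρ
      rw [eq_edgeTop (by omega : (edgeComplex k).dim ρ ≠ 0), edgeWeight_top, edgeWeight_top]
      exact hyy
  exact ⟨h1, ⟨r, hsub r hr, hr'⟩, ⟨s, hsub s hs, hs'⟩⟩

/-- Only the edge moves. The rectangle overestimates the region it sweeps, but is precise enough
once `y` is strictly beyond the midpoint of `[a, d]`. -/
theorem sum_cellDist_edgeWeight_le {a y y' : ℝ} (hy : a ≤ y) (hyy : y ≤ y') (i : ℕ) :
    ∑ σ with (edgeComplex k).dim σ = i ∨ (edgeComplex k).dim σ = i + 1,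
      (edgeComplex k).cellDist (edgeWeight k hy) (edgeWeight k (hy.trans hyy)) c d σ ≤
      volume (Set.Ico y y' ×ˢ Set.Icc y d) := by
  classical
  refine (Finset.sum_le_sum_of_subset (Finset.subset_univ _)).trans ?_
  rw [Finset.sum_eq_single edgeTop]
  · rw [CellComplex.cellDist, edgeWeight_top, edgeWeight_top, dRk_eq_lintegral]
    refine lintegral_rankDiff_le_volume (measurableSet_Ico.prod measurableSet_Icc) fun p hp => ?_
    simp only [mem_rankSupport_freeInterval]
    constructor
    · rintro ⟨h1, h2, h3, h4⟩
      refine ⟨h1, h2, h3, ?_⟩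
      by_contra h5
      exact hp ⟨⟨h4, not_le.1 h5⟩, h4.trans h1, h3⟩
    · rintro ⟨h1, h2, h3, h4⟩
      exact ⟨h1, h2, h3, hyy.trans h4⟩
  · intro σ _ hσ
    have hdim : (edgeComplex k).dim σ = 0 := by
      by_contra h
      exact hσ (eq_edgeTop h)
    rw [CellComplex.cellDist, edgeWeight_of_dim _ hdim, edgeWeight_of_dim _ hdim, dRk_self]
  · intro h
    exact absurd (Finset.mem_univ _) h

/-- The stability inequalities for the edge force the upper end of the parameter interval. -/
theorem BarcodeStable.two_mul_sub_le {𝒦 : Set (CellComplex k)} (h𝒦 : edgeComplex k ∈ 𝒦)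
    {a b : ℝ} (hca : c ≤ a) (had : a < d) (h : BarcodeStable 𝒦 a b c d) : 2 * b - a ≤ d := by
  by_contra hlt
  -- With `y` beyond the midpoint, `y - a > d - y`. Taking `y' = min b d` keeps the edge both in the
  -- range of the weights and in the window.
  have hmid : (a + d) / 2 < min b d := lt_min (by linarith) (by linarith)
  obtain ⟨y, hy1, hy2⟩ := exists_between hmid
  have hay : a ≤ y := by linarith
  have hyy : y ≤ min b d := hy2.le
  have hb := (h (edgeComplex k) h𝒦 (edgeWeight k hay) (edgeWeight k (hay.trans hyy))
    (edgeWeight_mem hay (hyy.trans (min_le_left b d)))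
    (edgeWeight_mem _ (min_le_left b d))).2 0
  have hlow : volume (Set.Icc a y ×ˢ Set.Ico y (min b d)) ≤
      wassersteinRk ((edgeComplex k).persistentHomology (edgeWeight k hay) c d 0)
        ((edgeComplex k).persistentHomology (edgeWeight k (hay.trans hyy)) c d 0) := by
    refine le_trans ?_ (lintegral_abs_rankFunction_sub_le_wassersteinRk _ _)
    refine volume_le_lintegral_rankDiff (measurableSet_Icc.prod measurableSet_Ico) fun p hp => ?_
    rw [← ENNReal.ofReal_one]
    exact ENNReal.ofReal_le_ofReal
      (one_le_abs_rankFunction_sub hca hay hyy (min_le_right b d) hp)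
  have hfin := hlow.trans (hb.trans (sum_cellDist_edgeWeight_le hay hyy 0))
  rw [Measure.volume_eq_prod, Measure.prod_prod, Measure.prod_prod, Real.volume_Icc,
    Real.volume_Ico, Real.volume_Icc, ← ENNReal.ofReal_mul (by linarith),
    ← ENNReal.ofReal_mul (by linarith)] at hfin
  rw [ENNReal.ofReal_le_ofReal_iff (mul_nonneg (by linarith)
    (sub_nonneg.2 (hyy.trans (min_le_right b d))))] at hfin
  have h3 : 0 < (min b d - y) * ((y - a) - (d - y)) := mul_pos (by linarith) (by linarith)
  linarith

end Edge

/-! ### The criterion for stability and the optimal window. -/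

section Main

variable {k : Type u} [Field k]

theorem barcodeStable_of_le (𝒦 : Set (CellComplex k)) {a b c d : ℝ} (hca : c ≤ a)
    (hd : 2 * b - a ≤ d) : BarcodeStable 𝒦 a b c d :=
  fun _ _ w v hw hv => (CellComplex.hasBoundedMatching hca hd w v hw hv).barcodeBound

/-- Representing constant weights puts `a` and `b` in `[c, d]`. The edge settles the case `a < d`;
if `a = d`, then `b ≤ d = a` and the bound is immediate. -/
theorem stableOn_iff {𝒦 : Set (CellComplex k)} (h𝒦 : edgeComplex k ∈ 𝒦) {a b : ℝ} (hab : a ≤ b)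
    (c d : ℝ) : StableOn 𝒦 a b c d ↔ c ≤ a ∧ 2 * b - a ≤ d := by
  constructor
  · rintro ⟨hrep, hst⟩
    have hmem : ∀ x ∈ Set.Icc a b, x ∈ Set.Icc c d := fun x hx =>
      (hrep (edgeComplex k) h𝒦 (OrderHom.const _ x) (fun _ => hx) edgeTop).1.1
    have ha := hmem a ⟨le_rfl, hab⟩
    have hb := hmem b ⟨hab, le_rfl⟩
    refine ⟨ha.1, ?_⟩
    rcases ha.2.lt_or_eq with hlt | heq
    · exact hst.two_mul_sub_le h𝒦 ha.1 hlt
    · linarith [hb.2]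
  · rintro ⟨hca, hd⟩
    refine ⟨fun K _ w hw σ => ⟨⟨⟨hca.trans (hw σ).1, ?_⟩, le_refl (w σ)⟩, fun t ht => ht.2⟩,
      barcodeStable_of_le 𝒦 hca hd⟩
    linarith [(hw σ).2]

end Main

theorem mainTheorem5 {k : Type*} [Field k] (𝒦 : Set (CellComplex k))
    (h𝒦 : ∀ K : CellComplex k, K.IsSimplicial → K ∈ 𝒦) (a b : ℝ) (hab : a ≤ b) :
    -- stability on `[c, d]`
    (∀ c d : ℝ, StableOn 𝒦 a b c d ↔ c ≤ a ∧ 2 * b - a ≤ d) ∧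
    -- the upper endpoint is forced by the stability inequalities alone
    (∀ c d : ℝ, c ≤ a → a < d → (BarcodeStable 𝒦 a b c d ↔ 2 * b - a ≤ d)) ∧
    -- `[a, 2b - a]` is optimal: it is stable, it is contained in every interval on which
    -- stability holds, and it gives the smallest upper bound
    StableOn 𝒦 a b a (2 * b - a) ∧
    ∀ c d : ℝ, StableOn 𝒦 a b c d →
      Set.Icc a (2 * b - a) ⊆ Set.Icc c d ∧
      ∀ K ∈ 𝒦, ∀ w v : K.Cell →o ℝ, (∀ σ, w σ ∈ Set.Icc a b) → (∀ σ, v σ ∈ Set.Icc a b) →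
        ∀ σ, K.cellDist w v a (2 * b - a) σ ≤ K.cellDist w v c d σ := by
  have hedge := h𝒦 _ (edgeComplex_isSimplicial k)
  refine ⟨stableOn_iff hedge hab, fun c d hca had =>
    ⟨fun h => h.two_mul_sub_le hedge hca had, barcodeStable_of_le 𝒦 hca⟩,
    (stableOn_iff hedge hab _ _).2 ⟨le_rfl, le_rfl⟩, fun c d h => ?_⟩
  obtain ⟨hca, hd⟩ := (stableOn_iff hedge hab c d).1 h
  exact ⟨Set.Icc_subset_Icc hca hd, fun K _ w v _ _ σ => dRk_freeInterval_mono hca hd⟩
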